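/- For a finite directed graph $D$, let $\Delta(D)$ be the simplicial complex whose vertices are the directed edges of $D$ and whose faces are the edge sets of the directed forests that are subgraphs of $D$. Here a directed tree with root $r$ is an acyclic directed graph in which every vertex $x$ is reached from $r$ by a unique directed path, and a directed forest is a family of vertex-disjoint directed trees. Let $n\ge 3$, and let $\overrightarrow{C}_n$ be the directed graph obtained from the cycle $C_n$ with $n$ vertices by replacing every edge $xy$ by the two directed edges $\overrightarrow{xy}$ and $\overrightarrow{yx}$. Write $\Delta^{(k)}$ for the $k$-skeleton of $\Delta=\Delta(\overrightarrow{C}_n)$, consisting of all faces of dimension at most $k$. A $d$-dimensional complex is pure if every face of dimension less than $d$ lies in a $d$-dimensional face. Let $m_{C_n}$ be the maximal dimension of a skeleton of $\Delta(\overrightarrow{C}_n)$ that is pure. A simplicial complex is shellable if it is pure and its maximal faces can be ordered $F_1,\dots,F_t$ so that for all $i<j\le t$ there are $l<j$ and a vertex $v\in F_j$ with $$F_i\cap F_j\subseteq F_l\cap F_j=F_j\setminus\{v\}.$$ **Theorem.** For every $n\ge 3$, the complex $\Delta^{(m_{C_n})}(\overrightarrow{C}_n)$ is shellable if and only if $n=3k$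 or $n=3k+1$ for some integer $k$. -/

import Mathlib

namespace TreeComplex

/-! ### Directed trees and directed forests

Directed graphs are given by their sets of edges; the pair `(x, y)` is the edge from `x` to `y`. -/

section Forests

variable {V : Type*}

/-- The list `p` of pairwise distinct vertices is a directed path from `x` to `y`
along edges in `E`. -/
structure IsDirectedPath (E : Set (V × V)) (x y : V) (p : List V) : Prop where
  head : p.head? = some x
  last : p.getLast? = some y
  chain : p.IsChain (fun a b => (a, b) ∈ E)
  nodup : p.Nodup

/-- There is no closed directed walk of positive length (in particular no loop and no pair of
opposite edges). -/
def IsAcyclic (E : Set (V × V)) : Prop :=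
  ∀ x, ¬ Relation.TransGen (fun a b => (a, b) ∈ E) x x

/-- The directed graph with vertex set `W` and edge set `E` is a directed tree with root `r`. -/
structure IsDirectedTree (W : Set V) (E : Set (V × V)) (r : V) : Prop where
  edge_mem : ∀ e ∈ E, e.1 ∈ W ∧ e.2 ∈ W
  acyclic : IsAcyclic E
  root_mem : r ∈ W
  existsUnique_path : ∀ x ∈ W, ∃! p : List V, IsDirectedPath E r x p

/-- `E` is the edge set of a directed forest, that is, of a family of (vertex-)disjoint
directed trees `(W, E')`. -/
def IsDirectedForest (E : Set (V × V)) : Prop :=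
  ∃ T : Set (Set V × Set (V × V)),
    (∀ t ∈ T, ∃ r, IsDirectedTree t.1 t.2 r) ∧
    T.PairwiseDisjoint Prod.fst ∧
    E = ⋃ t ∈ T, t.2

theorem IsDirectedForest.acyclic {E : Set (V × V)} (h : IsDirectedForest E) : IsAcyclic E := by
  obtain ⟨T, hT, hd, rfl⟩ := h
  have key : ∀ x y, Relation.TransGen (fun a b => (a, b) ∈ ⋃ t ∈ T, t.2) x y →
      ∀ t ∈ T, x ∈ t.1 → Relation.TransGen (fun a b => (a, b) ∈ t.2) x y ∧ y ∈ t.1 := by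
    have step : ∀ a b, (a, b) ∈ ⋃ t ∈ T, t.2 → ∀ t ∈ T, a ∈ t.1 → (a, b) ∈ t.2 ∧ b ∈ t.1 := by
      intro a b hab t ht hat
      simp only [Set.mem_iUnion, exists_prop] at hab
      obtain ⟨u, hu, hab⟩ := hab
      obtain ⟨r, hr⟩ := hT u hu
      have h1 := hr.edge_mem _ hab
      have : t = u := by
        by_contra hne
        exact Set.disjoint_left.1 (hd ht hu hne) hat h1.1
      subst this
      exact ⟨hab, h1.2⟩
    intro x y hxy t ht hxt
    induction hxy with
    | single h => exact ⟨.single (step _ _ h t ht hxt).1, (step _ _ h t ht hxt).2⟩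
    | tail _ h ih => exact ⟨.tail ih.1 (step _ _ h t ht ih.2).1, (step _ _ h t ht ih.2).2⟩
  intro x hx
  obtain ⟨b, hb, -⟩ := Relation.TransGen.head'_iff.1 hx
  simp only [Set.mem_iUnion, exists_prop] at hb
  obtain ⟨t, ht, hb⟩ := hb
  obtain ⟨r, hr⟩ := hT t ht
  exact hr.acyclic x (key x x hx t ht (hr.edge_mem _ hb).1).1

theorem reflTransGen_of_mem_isChain {R : V → V → Prop} :
    ∀ {p : List V} {x y : V}, p.IsChain R → p.getLast? = some y → x ∈ p →
      Relation.ReflTransGen R x y := by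
  intro p
  induction p with
  | nil => intro x y _ _ h; simp at h
  | cons a l ih =>
    intro x y hc hl hx
    cases l with
    | nil =>
      simp at hl hx
      subst hl; subst hx; exact .refl
    | cons b l =>
      rw [List.isChain_cons_cons] at hc
      have hl' : (b :: l).getLast? = some y := by simpa using hl
      rcases List.mem_cons.1 hx with rfl | hx
      · exact .head hc.1 (ih hc.2 hl' (by simp))
      · exact ih hc.2 hl' hx

theorem IsDirectedPath.concat {E : Set (V × V)} (hE : IsAcyclic E) {x y z : V} {p : List V}
    (h : IsDirectedPath E x y p) (hyz : (y, z) ∈ E) : IsDirectedPath E x z (p ++ [z]) where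
  head := by
    have := h.head
    cases p <;> simp_all
  last := by simp
  chain := by
    rw [List.isChain_append]
    refine ⟨h.chain, by simp, ?_⟩
    intro a ha b hb
    rw [h.last] at ha
    simp at ha hb
    subst ha; subst hb; exact hyz
  nodup := by
    refine List.nodup_append.2 ⟨h.nodup, by simp, ?_⟩
    intro a ha b hb hab
    simp at hb
    subst hb; subst hab
    exact hE a (Relation.TransGen.tail' (reflTransGen_of_mem_isChain h.chain h.last ha) hyz)

theorem IsDirectedForest.eq_of_mem {E : Set (V × V)} (h : IsDirectedForest E) {a a' b : V}
    (hab : (a, b) ∈ E) (hab' : (a', b) ∈ E) : a = a' := by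
  obtain ⟨T, hT, hd, rfl⟩ := h
  simp only [Set.mem_iUnion, exists_prop] at hab hab'
  obtain ⟨t, ht, hab⟩ := hab
  obtain ⟨u, hu, hab'⟩ := hab'
  obtain ⟨r, hr⟩ := hT t ht
  obtain ⟨s, hs⟩ := hT u hu
  have : t = u := by
    by_contra hne
    exact Set.disjoint_left.1 (hd ht hu hne) (hr.edge_mem _ hab).2 (hs.edge_mem _ hab').2
  subst this
  obtain ⟨p, hp, -⟩ := hr.existsUnique_path a (hr.edge_mem _ hab).1
  obtain ⟨p', hp', -⟩ := hr.existsUnique_path a' (hr.edge_mem _ hab').1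
  have := (hr.existsUnique_path b (hr.edge_mem _ hab).2).unique
    (hp.concat hr.acyclic hab) (hp'.concat hr.acyclic hab')
  have hpp : p = p' := by simpa using this
  have h1 := hp.last
  rw [hpp, hp'.last] at h1
  exact (Option.some.inj h1).symm

theorem IsDirectedPath.exists_of_reflTransGen {E : Set (V × V)} (hE : IsAcyclic E) {x y : V}
    (h : Relation.ReflTransGen (fun a b => (a, b) ∈ E) x y) : ∃ p, IsDirectedPath E x y p := by
  induction h with
  | refl => exact ⟨[x], by simp, by simp, by simp, by simp⟩
  | tail _ hbc ih =>
    obtain ⟨p, hp⟩ := ih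
    exact ⟨_, hp.concat hE hbc⟩

theorem IsDirectedPath.unique {E : Set (V × V)} (hin : ∀ a a' b, (a, b) ∈ E → (a', b) ∈ E → a = a')
    {r : V} (hr : ∀ a, (a, r) ∉ E) (p : List V) :
    ∀ {y : V} {q : List V}, IsDirectedPath E r y p → IsDirectedPath E r y q → p = q := by
  induction p using List.reverseRecOn with
  | nil => intro y q hp; simpa using hp.head
  | append_singleton p b ih =>
    intro y q hp hq
    obtain rfl : b = y := by simpa using hp.last
    rcases List.eq_nil_or_concat q with rfl | ⟨q, c, rfl⟩
    · simpa using hq.head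
    rw [List.concat_eq_append] at hq ⊢
    obtain rfl : c = b := by simpa using hq.last
    have aux : ∀ {l : List V}, IsDirectedPath E r c (l ++ [c]) →
        (l = [] ∧ c = r) ∨ ∃ a, (a, c) ∈ E ∧ IsDirectedPath E r a l := by
      intro l hl
      rcases List.eq_nil_or_concat l with rfl | ⟨l, a, rfl⟩
      · left; simpa using hl.head
      · rw [List.concat_eq_append] at hl ⊢
        right
        have hc := List.isChain_append.1 hl.chain
        refine ⟨a, hc.2.2 a (by simp) c (by simp), ?_, by simp, hc.1,
          (List.nodup_append.1 hl.nodup).1⟩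
        have := hl.head
        cases l <;> simp_all
    rcases aux hp with ⟨rfl, rfl⟩ | ⟨a, ha, hpa⟩ <;> rcases aux hq with ⟨rfl, h⟩ | ⟨a', ha', hqa⟩
    · rfl
    · exact absurd ha' (hr _)
    · exact absurd (h ▸ ha) (hr _)
    · obtain rfl := hin _ _ _ ha ha'
      rw [ih hpa hqa]

/-- On a finite vertex set, the directed forests are the acyclic directed graphs in which every
vertex has in-degree at most one. -/
theorem isDirectedForest_iff [Finite V] {E : Set (V × V)} :
    IsDirectedForest E ↔
      IsAcyclic E ∧ ∀ a a' b, (a, b) ∈ E → (a', b) ∈ E → a = a' := by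
  refine ⟨fun h => ⟨h.acyclic, fun a a' b => h.eq_of_mem⟩, fun ⟨hE, hin⟩ => ?_⟩
  let R : V → V → Prop := fun a b => (a, b) ∈ E
  let W : V → Set V := fun r => {x | Relation.ReflTransGen R r x}
  let F : V → Set (V × V) := fun r => {e | e ∈ E ∧ e.1 ∈ W r}
  have hF : ∀ r, IsAcyclic (F r) := fun r x hx =>
    hE x (Relation.TransGen.mono (fun a b h => h.1) x x hx)
  refine ⟨{t | ∃ r, (∀ a, (a, r) ∉ E) ∧ t = (W r, F r)}, ?_, ?_, ?_⟩
  · rintro _ ⟨r, hr, rfl⟩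
    refine ⟨r, ?_, hF r, .refl, ?_⟩
    · rintro ⟨a, b⟩ ⟨h1, h2⟩
      exact ⟨h2, Relation.ReflTransGen.tail h2 h1⟩
    · intro x hx
      have hx' : Relation.ReflTransGen (fun a b => (a, b) ∈ F r) r x := by
        change Relation.ReflTransGen R r x at hx
        induction hx with
        | refl => exact .refl
        | tail h1 h2 ih => exact ih.tail ⟨h2, h1⟩
      obtain ⟨p, hp⟩ := IsDirectedPath.exists_of_reflTransGen (hF r) hx'
      refine ⟨p, hp, fun q hq => ?_⟩
      exact IsDirectedPath.unique (fun a a' b h h' => hin a a' b h.1 h'.1)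
        (fun a h => hr a h.1) q hq hp
  · rintro _ ⟨r, hr, rfl⟩ _ ⟨s, hs, rfl⟩ hne
    refine Set.disjoint_left.2 fun x (hx : Relation.ReflTransGen R r x)
      (hx' : Relation.ReflTransGen R s x) => hne ?_
    suffices h : r = s by rw [h]
    have hx1 := Relation.reflTransGen_swap.2 hx
    have hx2 := Relation.reflTransGen_swap.2 hx'
    have hroot : ∀ {u v : V}, (∀ a, (a, v) ∉ E) → Relation.ReflTransGen R u v → u = v := by
      intro u v hv huv
      rcases Relation.ReflTransGen.cases_tail huv with h | ⟨c, -, hc⟩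
      · exact h.symm
      · exact absurd hc (hv c)
    rcases Relation.ReflTransGen.total_of_right_unique
      (fun b a a' h h' => hin a a' b h h') hx1 hx2 with h | h
    · exact (hroot hr (Relation.reflTransGen_swap.1 h)).symm
    · exact hroot hs (Relation.reflTransGen_swap.1 h)
  · have hwf : WellFounded (Relation.TransGen R) := by
      have : Std.Irrefl (Relation.TransGen R) := ⟨hE⟩
      exact Finite.wellFounded_of_trans_of_irrefl _
    have hroot : ∀ x, ∃ r, (∀ a, (a, r) ∉ E) ∧ x ∈ W r := by
      intro x
      induction x using hwf.induction with
      | _ x ih =>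
        by_cases h : ∀ a, (a, x) ∉ E
        · exact ⟨x, h, .refl⟩
        · push Not at h
          obtain ⟨a, ha⟩ := h
          obtain ⟨r, hr, har⟩ := ih a (.single ha)
          exact ⟨r, hr, Relation.ReflTransGen.tail har ha⟩
    ext ⟨a, b⟩
    simp only [Set.mem_iUnion, exists_prop]
    constructor
    · intro hab
      obtain ⟨r, hr, ha⟩ := hroot a
      exact ⟨_, ⟨r, hr, rfl⟩, hab, ha⟩
    · rintro ⟨_, ⟨r, hr, rfl⟩, h, -⟩
      exact h

/-- The edges of a subgraph of a directed forest form a directed forest. -/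
theorem IsDirectedForest.mono [Finite V] {E E' : Set (V × V)} (h : IsDirectedForest E)
    (hE : E' ⊆ E) : IsDirectedForest E' := by
  rw [isDirectedForest_iff] at h ⊢
  exact ⟨fun x hx => h.1 x (Relation.TransGen.mono (fun a b hab => hE hab) x x hx),
    fun a a' b hab hab' => h.2 a a' b (hE hab) (hE hab')⟩

end Forests

/-! ### Simplicial complexes

A `PreAbstractSimplicialComplex ι` is Mathlib's abstract simplicial complex: a family of nonempty
finite subsets of `ι` closed under passing to nonempty subsets. Its vertices are the `v` for which
`{v}` is a face. A face with `d + 1` elements has dimension `d`. -/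

section Complexes

variable {ι : Type*}

/-- The `k`-skeleton: all faces of dimension at most `k`. -/
def skeleton (K : PreAbstractSimplicialComplex ι) (k : ℕ) : PreAbstractSimplicialComplex ι where
  faces := {s | s ∈ K.faces ∧ s.card ≤ k + 1}
  isRelLowerSet_faces := fun _ hs =>
    ⟨(K.isRelLowerSet_faces hs.1).1, fun _ hts ht =>
      ⟨(K.isRelLowerSet_faces hs.1).2 hts ht, (Finset.card_le_card hts).trans hs.2⟩⟩

/-- The complex `K` is `d`-dimensional: `d` is the largest dimension of a face. -/
def HasDimension (K : PreAbstractSimplicialComplex ι) (d : ℕ) : Prop :=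
  IsGreatest {i : ℕ | ∃ s ∈ K.faces, s.card = i + 1} d

/-- `K` is `d`-dimensional and every face of dimension less than `d` is contained in a
`d`-dimensional face. -/
def IsPureOfDimension (K : PreAbstractSimplicialComplex ι) (d : ℕ) : Prop :=
  HasDimension K d ∧
    ∀ s ∈ K.faces, s.card < d + 1 → ∃ t ∈ K.faces, s ⊆ t ∧ t.card = d + 1

/-- A complex is pure if it is empty or pure of some dimension. -/
def IsPure (K : PreAbstractSimplicialComplex ι) : Prop :=
  K.faces = ∅ ∨ ∃ d, IsPureOfDimension K d

/-- A facet is an inclusion-maximal face. -/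
def IsFacet (K : PreAbstractSimplicialComplex ι) (s : Finset ι) : Prop :=
  Maximal (fun t => t ∈ K.faces) s

/-- `K` is pure, and its facets can be listed without repetition as `F 0, …, F (m - 1)` such that
for all `i < j` there are `l < j` and `v ∈ F j` with `F i ∩ F j ⊆ F l ∩ F j = F j \ {v}`. -/
def IsShellable [DecidableEq ι] (K : PreAbstractSimplicialComplex ι) : Prop :=
  IsPure K ∧
    ∃ (m : ℕ) (F : Fin m → Finset ι), Function.Injective F ∧
      (∀ s, IsFacet K s ↔ ∃ i, F i = s) ∧
      ∀ i j : Fin m, i < j → ∃ l : Fin m, l < j ∧ ∃ v ∈ F j,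
        F i ∩ F j ⊆ F l ∩ F j ∧ F l ∩ F j = F j \ {v}

/-- The maximal dimension of a skeleton of `K` that is pure. -/
noncomputable def maxPureSkeletonDim (K : PreAbstractSimplicialComplex ι) : ℕ :=
  sSup {d : ℕ | ∃ k : ℕ, IsPureOfDimension (skeleton K k) d}

/-- For a nonempty finite complex the supremum defining `maxPureSkeletonDim` is a maximum. -/
theorem isGreatest_maxPureSkeletonDim [Finite ι] (K : PreAbstractSimplicialComplex ι)
    (hK : K.faces.Nonempty) :
    IsGreatest {d : ℕ | ∃ k : ℕ, IsPureOfDimension (skeleton K k) d} (maxPureSkeletonDim K) := by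
  have := Fintype.ofFinite ι
  have hne : {d : ℕ | ∃ k : ℕ, IsPureOfDimension (skeleton K k) d}.Nonempty := by
    obtain ⟨s, hs⟩ := hK
    obtain ⟨v, hv⟩ := (K.isRelLowerSet_faces hs).1
    have hv' : {v} ∈ K.faces :=
      (K.isRelLowerSet_faces hs).2 (Finset.singleton_subset_iff.2 hv) (Finset.singleton_nonempty v)
    refine ⟨0, 0, ⟨⟨{v}, ⟨hv', by simp⟩, by simp⟩, ?_⟩, ?_⟩
    · rintro i ⟨t, ht, hi⟩
      have := ht.2
      omega
    · intro t ht h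
      have := ((skeleton K 0).isRelLowerSet_faces ht).1.card_pos
      omega
  have hbd : BddAbove {d : ℕ | ∃ k : ℕ, IsPureOfDimension (skeleton K k) d} := by
    refine ⟨Fintype.card ι, ?_⟩
    rintro d ⟨k, ⟨⟨s, -, hs⟩, -⟩, -⟩
    have := s.card_le_univ
    omega
  exact ⟨Nat.sSup_mem hne hbd, fun d hd => le_csSup hbd hd⟩

end Complexes

/-! ### The complex of directed trees -/

/-- The complex of directed trees of a finite directed graph `D`: its vertices are edges of `D`, and
its faces are the (nonempty) edge sets of directed forests that are subgraphs of `D`. -/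
def directedTreeComplex {V : Type*} [Finite V] (D : Digraph V) :
    PreAbstractSimplicialComplex (V × V) where
  faces := {s | s.Nonempty ∧ (∀ e ∈ s, D.Adj e.1 e.2) ∧ IsDirectedForest (s : Set (V × V))}
  isRelLowerSet_faces := fun _ hs =>
    ⟨hs.1, fun _ hts ht =>
      ⟨ht, fun e he => hs.2.1 e (hts he), hs.2.2.mono (Finset.coe_subset.2 hts)⟩⟩

/-- The directed graph obtained from a simple graph by replacing every edge `xy` by the two
directed edges from `x` to `y` and from `y` to `x`. -/
def doubleDigraph {V : Type*} (G : SimpleGraph V) : Digraph V where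
  Adj := G.Adj

end TreeComplex

/-! The 2n edges of the doubled cycle can be numbered cyclically so that two of them conflict
(opposite edges, or edges with a common head) exactly when their numbers are neighbours; this is
`cycleEdge`. Hence the faces are the nonempty independent sets of a cycle of length N = 2n, apart
from the two of size n, which are the directed n-cycles. An independent set with fewer than N/3
elements can be enlarged, which makes low skeleta pure. If N is not 1 mod 3, then {1, 4, 7, …} is a
maximal independent set, which bounds the dimension m of a pure skeleton from above. Neither
direction needs the exact value of m.

If n = 3k or n = 3k + 1, the upper bound gives 3m + 2 ≤ N. Under this inequality the independent
sets of size m + 1 are shelled by taking those avoiding the last vertex of the cycle before those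
containing it (`exists_shellExt_cycle`); both classes reduce to independent sets of paths
(`shellExt_pathFamily`).

If n = 3k + 2, then N = 3t + 1 with t = 2k + 1, and m ≥ t, so facets have more than t elements. A
shelling would force every mod 2 cocycle to vanish on every mod 2 cycle in dimension t - 1
(`sum_cocycle_mul_cycle_eq_zero`). But the pairs {3i + 1, 3i + 2}, i < t, span the boundary of a
cross-polytope, a (t - 1)-sphere of independent sets, and an explicit cocycle takes the value 1 on
it (`not_shelling_cycle`). -/

namespace TreeComplex

/-! ### Building shelling orders by extension -/

section Shelling

variable {α β : Type*} [DecidableEq α] [DecidableEq β]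

/-- The family `𝓕` arises from `𝓐` by adding sets one at a time, each of them satisfying
the shelling condition with respect to the sets already present. -/
inductive ShellExt (𝓐 : Finset (Finset α)) : Finset (Finset α) → Prop
  | refl : ShellExt 𝓐 𝓐
  | step (𝓕 : Finset (Finset α)) (F : Finset α) : ShellExt 𝓐 𝓕 → F ∉ 𝓕 →
      (∀ A ∈ 𝓕, ∃ B ∈ 𝓕, ∃ v ∈ F, A ∩ F ⊆ B ∩ F ∧ B ∩ F = F \ {v}) → ShellExt 𝓐 (insert F 𝓕)

theorem ShellExt.trans {𝓐 𝓑 𝓒 : Finset (Finset α)} (h : ShellExt 𝓐 𝓑) (h' : ShellExt 𝓑 𝓒) :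
    ShellExt 𝓐 𝓒 := by
  induction h' with
  | refl => exact h
  | step 𝓕 F _ hF hs ih => exact .step 𝓕 F ih hF hs

theorem ShellExt.of_card_le_one {𝓕 : Finset (Finset α)} (h : 𝓕.card ≤ 1) : ShellExt ∅ 𝓕 := by
  rcases Finset.card_le_one_iff_subset_singleton.1 h with ⟨F, hF⟩
  rcases Finset.subset_singleton_iff.1 hF with rfl | rfl
  · exact .refl
  · exact .step ∅ F .refl (by simp) (by simp)

/-- An earlier `A` avoids `v`, so it meets `insert v G` inside `G`, and a `B ∈ 𝓐` containing `G`
meets it in exactly `G`: the removed vertex is `v`. Among the new sets the shelling of `𝓕` is simply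
coned. Since `hAF` is vacuous for `𝓐 = ∅`, the lemma also shells a bare cone. -/
theorem ShellExt.link {𝓐 𝓕 : Finset (Finset α)} {v : α} (h : ShellExt ∅ 𝓕)
    (hA : ∀ A ∈ 𝓐, v ∉ A) (hF : ∀ G ∈ 𝓕, v ∉ G)
    (hAF : ∀ A ∈ 𝓐, ∀ G ∈ 𝓕, ∃ B ∈ 𝓐, G ⊆ B) :
    ShellExt 𝓐 (𝓐 ∪ 𝓕.image (insert v)) := by
  induction h with
  | refl => simpa using ShellExt.refl
  | step 𝓕 G _ hG hs ih =>
    have ih := ih (fun G hG => hF G (Finset.mem_insert_of_mem hG))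
      (fun A hA G hG => hAF A hA G (Finset.mem_insert_of_mem hG))
    have hvG : v ∉ G := hF G (Finset.mem_insert_self _ _)
    rw [Finset.image_insert, Finset.union_insert]
    refine .step _ _ ih ?_ ?_
    · intro hmem
      rcases Finset.mem_union.1 hmem with h | h
      · exact hA _ h (Finset.mem_insert_self _ _)
      · obtain ⟨G', hG', he⟩ := Finset.mem_image.1 h
        have hv' : v ∉ G' := hF G' (Finset.mem_insert_of_mem hG')
        have : G' = G := by
          rw [← Finset.erase_insert hv', he, Finset.erase_insert hvG]
        exact hG (this ▸ hG')
    · intro A hAm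
      rcases Finset.mem_union.1 hAm with h | h
      · obtain ⟨B, hB, hGB⟩ := hAF A h G (Finset.mem_insert_self _ _)
        have hvA := hA A h
        have hvB := hA B hB
        refine ⟨B, Finset.mem_union_left _ hB, v, Finset.mem_insert_self _ _, ?_, ?_⟩
        · intro x hx
          simp only [Finset.mem_inter, Finset.mem_insert] at hx ⊢
          rcases hx.2 with rfl | hxG
          · exact absurd hx.1 hvA
          · exact ⟨hGB hxG, Or.inr hxG⟩
        · ext x
          simp only [Finset.mem_inter, Finset.mem_insert, Finset.mem_sdiff, Finset.mem_singleton]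
          constructor
          · rintro ⟨h1, h2⟩
            exact ⟨h2, fun h => hvB (h ▸ h1)⟩
          · rintro ⟨h1, h2⟩
            exact ⟨hGB (h1.resolve_left h2), h1⟩
      · obtain ⟨A', hA', rfl⟩ := Finset.mem_image.1 h
        obtain ⟨B, hB, u, hu, h1, h2⟩ := hs A' hA'
        refine ⟨insert v B, Finset.mem_union_right _ (Finset.mem_image_of_mem _ hB), u,
          Finset.mem_insert_of_mem hu, ?_, ?_⟩
        · rw [← Finset.insert_inter_distrib, ← Finset.insert_inter_distrib]
          exact Finset.insert_subset_insert _ h1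
        · have huv : v ≠ u := fun h => hvG (h ▸ hu)
          rw [← Finset.insert_inter_distrib, h2,
            Finset.insert_sdiff_of_notMem _ (by simpa using huv)]

/-- All witnesses lie in `𝓐`, so the members of `𝓑` can be added in any order. -/
theorem ShellExt.union {𝓐 𝓑 : Finset (Finset α)} (hd : Disjoint 𝓐 𝓑)
    (h : ∀ F ∈ 𝓑, ∀ A ∈ 𝓐 ∪ 𝓑, A ≠ F → ∃ B ∈ 𝓐, ∃ v ∈ F, A ∩ F ⊆ B ∩ F ∧ B ∩ F = F \ {v}) :
    ShellExt 𝓐 (𝓐 ∪ 𝓑) := by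
  induction 𝓑 using Finset.induction_on with
  | empty => simpa using ShellExt.refl
  | insert F 𝓑 hF ih =>
    rw [Finset.disjoint_insert_right] at hd
    rw [Finset.union_insert]
    refine .step _ _ (ih hd.2 fun G hG A hA hne => h G (Finset.mem_insert_of_mem hG) A ?_ hne) ?_ ?_
    · rw [Finset.union_insert]
      exact Finset.mem_insert_of_mem hA
    · simp [hF, hd.1]
    · intro A hA
      have hne : A ≠ F := by
        rintro rfl
        rcases Finset.mem_union.1 hA with h | h
        · exact hd.1 h
        · exact hF h
      obtain ⟨B, hB, v, hv, h1, h2⟩ := h F (Finset.mem_insert_self _ _) A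
        (by rw [Finset.union_insert]; exact Finset.mem_insert_of_mem hA) hne
      exact ⟨B, Finset.mem_union_left _ hB, v, hv, h1, h2⟩

theorem ShellExt.image {𝓕 : Finset (Finset α)} (h : ShellExt ∅ 𝓕) {U : Set α} {f : α → β}
    (hf : Set.InjOn f U) (hU : ∀ F ∈ 𝓕, (F : Set α) ⊆ U) :
    ShellExt ∅ (𝓕.image (Finset.image f)) := by
  have hinter : ∀ {A B : Finset α}, (A : Set α) ⊆ U → (B : Set α) ⊆ U →
      A.image f ∩ B.image f = (A ∩ B).image f := fun hA hB =>
    (Finset.image_inter_of_injOn _ _ (hf.mono (Set.union_subset hA hB))).symm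
  induction h with
  | refl => simpa using ShellExt.refl
  | step 𝓕 G _ hG hs ih =>
    have ih := ih fun F hF => hU F (Finset.mem_insert_of_mem hF)
    have hGU : (G : Set α) ⊆ U := hU G (Finset.mem_insert_self _ _)
    have hFU : ∀ F ∈ 𝓕, (F : Set α) ⊆ U := fun F hF => hU F (Finset.mem_insert_of_mem hF)
    rw [Finset.image_insert]
    refine .step _ _ ih ?_ ?_
    · intro hmem
      obtain ⟨F, hF, he⟩ := Finset.mem_image.1 hmem
      have : F = G := by
        have he' : f '' (F : Set α) = f '' (G : Set α) := by
          rw [← Finset.coe_image, he, Finset.coe_image]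
        exact Finset.coe_injective ((hf.image_eq_image_iff (hFU F hF) hGU).1 he')
      exact hG (this ▸ hF)
    · intro A' hA'
      obtain ⟨A, hA, rfl⟩ := Finset.mem_image.1 hA'
      obtain ⟨B, hB, v, hv, h1, h2⟩ := hs A hA
      refine ⟨_, Finset.mem_image_of_mem _ hB, f v, Finset.mem_image_of_mem _ hv, ?_, ?_⟩
      · rw [hinter (hFU A hA) hGU, hinter (hFU B hB) hGU]
        exact Finset.image_subset_image h1
      · rw [hinter (hFU B hB) hGU, h2]
        ext y
        simp only [Finset.mem_image, Finset.mem_sdiff, Finset.mem_singleton]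
        constructor
        · rintro ⟨x, ⟨hx, hxv⟩, rfl⟩
          exact ⟨⟨x, hx, rfl⟩, fun h => hxv (hf (hGU hx) (hGU hv) h)⟩
        · rintro ⟨⟨x, hx, rfl⟩, hxv⟩
          exact ⟨x, ⟨hx, fun h => hxv (h ▸ rfl)⟩, rfl⟩

theorem ShellExt.exists_fin {𝓕 : Finset (Finset α)} (h : ShellExt ∅ 𝓕) :
    ∃ (m : ℕ) (F : Fin m → Finset α), Function.Injective F ∧ (∀ s, s ∈ 𝓕 ↔ ∃ i, F i = s) ∧
      ∀ i j : Fin m, i < j → ∃ l : Fin m, l < j ∧ ∃ v ∈ F j,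
        F i ∩ F j ⊆ F l ∩ F j ∧ F l ∩ F j = F j \ {v} := by
  induction h with
  | refl => exact ⟨0, Fin.elim0, fun i => i.elim0, by simp, fun i => i.elim0⟩
  | step 𝓕 G _ hG hs ih =>
    obtain ⟨m, F, hinj, hmem, hsh⟩ := ih
    refine ⟨m + 1, Fin.snoc F G, ?_, ?_, ?_⟩
    · rw [Fin.snoc_injective_iff]
      refine ⟨hinj, ?_⟩
      rintro ⟨i, hi⟩
      exact hG ((hmem G).2 ⟨i, hi⟩)
    · intro s
      rw [Finset.mem_insert, hmem]
      constructor
      · rintro (rfl | ⟨i, rfl⟩)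
        · exact ⟨Fin.last m, by simp⟩
        · exact ⟨i.castSucc, by simp⟩
      · rintro ⟨i, rfl⟩
        induction i using Fin.lastCases with
        | last => simp
        | cast i => right; exact ⟨i, by simp⟩
    · intro i j hij
      induction j using Fin.lastCases with
      | last =>
        induction i using Fin.lastCases with
        | last => exact absurd hij (lt_irrefl _)
        | cast i =>
          obtain ⟨B, hB, v, hv, h1, h2⟩ := hs (F i) ((hmem _).2 ⟨i, rfl⟩)
          obtain ⟨l, rfl⟩ := (hmem B).1 hB
          exact ⟨l.castSucc, Fin.castSucc_lt_last l, v, by simpa using hv, by simpa using h1,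
            by simpa using h2⟩
      | cast j =>
        induction i using Fin.lastCases with
        | last => exact absurd hij (not_lt.2 (Fin.le_last _))
        | cast i =>
          obtain ⟨l, hl, v, hv, h1, h2⟩ := hsh i j (by simpa using hij)
          exact ⟨l.castSucc, by simpa using hl, v, by simpa using hv, by simpa using h1,
            by simpa using h2⟩

end Shelling

/-! ### Independent sets of paths and cycles, and their shellings -/

section Families

/-- The sets of `s` pairwise nonadjacent vertices of the path `0, …, M - 1`. -/
def pathFamily (M s : ℕ) : Finset (Finset ℕ) :=
  (Finset.range M).powerset.filter fun S => S.card = s ∧ ∀ x ∈ S, x + 1 ∉ S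

theorem mem_pathFamily {M s : ℕ} {S : Finset ℕ} :
    S ∈ pathFamily M s ↔ (∀ x ∈ S, x < M) ∧ S.card = s ∧ ∀ x ∈ S, x + 1 ∉ S := by
  simp [pathFamily, Finset.subset_iff]

/-- Sorts independent sets by their largest element `v`: the rest lives on the vertices below `v`
and not adjacent to it. The hypothesis `hM` says that `M` is the truncated difference `v - 1`. -/
theorem mem_image_insert_pathFamily {M M' s v : ℕ} (hv : M ≤ v) (hM : ∀ x, x < M ↔ x + 1 < v)
    (hM' : v < M') {S : Finset ℕ} :
    S ∈ (pathFamily M s).image (insert v) ↔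
      S ∈ pathFamily M' (s + 1) ∧ v ∈ S ∧ ∀ x ∈ S, x ≤ v := by
  simp only [Finset.mem_image, mem_pathFamily]
  constructor
  · rintro ⟨G, ⟨h1, h2, h3⟩, rfl⟩
    have hvG : v ∉ G := fun h => by have := h1 v h; omega
    refine ⟨⟨?_, by rw [Finset.card_insert_of_notMem hvG, h2], ?_⟩, by simp, ?_⟩
    · intro x hx
      rcases Finset.mem_insert.1 hx with rfl | hx
      · exact hM'
      · have := h1 x hx; omega
    · intro x hx hx1
      rcases Finset.mem_insert.1 hx with rfl | hx <;> rcases Finset.mem_insert.1 hx1 with h | hx1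
      · omega
      · have := h1 _ hx1; omega
      · have := (hM x).1 (h1 x hx); omega
      · exact h3 x hx hx1
    · intro x hx
      rcases Finset.mem_insert.1 hx with rfl | hx
      · exact le_rfl
      · have := h1 x hx; omega
  · rintro ⟨⟨h1, h2, h3⟩, hv, h4⟩
    refine ⟨S.erase v, ⟨?_, ?_, ?_⟩, Finset.insert_erase hv⟩
    · intro x hx
      obtain ⟨hxv, hx⟩ := Finset.mem_erase.1 hx
      rw [hM]
      have := h4 x hx
      have : x + 1 ≠ v := fun h => h3 x hx (h ▸ hv)
      omega
    · rw [Finset.card_erase_of_mem hv, h2]; rfl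
    · intro x hx hx1
      exact h3 x (Finset.mem_of_mem_erase hx) (Finset.mem_of_mem_erase hx1)

theorem pathFamily_add_two (M s : ℕ) :
    pathFamily (M + 2) (s + 1) = ((pathFamily M s).image (insert (M + 1)) ∪
      pathFamily M (s + 1)) ∪ (pathFamily (M - 1) s).image (insert M) := by
  ext S
  rw [Finset.mem_union, Finset.mem_union,
    mem_image_insert_pathFamily (M' := M + 2) (by omega) (by omega) (by omega),
    mem_image_insert_pathFamily (M' := M + 2) (by omega) (by omega) (by omega)]
  constructor
  · intro h
    obtain ⟨h1, h2, h3⟩ := mem_pathFamily.1 h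
    by_cases ha : M + 1 ∈ S
    · exact Or.inl (Or.inl ⟨h, ha, fun x hx => by have := h1 x hx; omega⟩)
    have h1' : ∀ x ∈ S, x < M + 1 := fun x hx => by
      have := h1 x hx
      have : x ≠ M + 1 := fun h => ha (h ▸ hx)
      omega
    by_cases hb : M ∈ S
    · exact Or.inr ⟨h, hb, fun x hx => by have := h1' x hx; omega⟩
    · refine Or.inl (Or.inr (mem_pathFamily.2 ⟨fun x hx => ?_, h2, h3⟩))
      have := h1' x hx
      have : x ≠ M := fun h => hb (h ▸ hx)
      omega
  · rintro ((h | h) | h)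
    · exact h.1
    · obtain ⟨h1, h2, h3⟩ := mem_pathFamily.1 h
      exact mem_pathFamily.2 ⟨fun x hx => by have := h1 x hx; omega, h2, h3⟩
    · exact h.1

/-- On the path with M + 2 vertices, the sets containing the end M + 1 come first (a cone), then
those avoiding both M and M + 1, then those containing M. In a set of the second kind any element
may be exchanged for M + 1, so their order is irrelevant; in one of the third kind M may be
exchanged for M + 1, which is the situation of `ShellExt.link`. -/
theorem shellExt_pathFamily : ∀ M s : ℕ, ShellExt ∅ (pathFamily M s)
  | M, 0 => by
    refine .of_card_le_one (Finset.card_le_one.2 fun A hA B hB => ?_)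
    rw [Finset.card_eq_zero.1 (mem_pathFamily.1 hA).2.1,
      Finset.card_eq_zero.1 (mem_pathFamily.1 hB).2.1]
  | 0, s + 1 => by
    refine .of_card_le_one (Finset.card_le_one.2 fun A hA B hB => ?_)
    have := (mem_pathFamily.1 hA).2.1
    obtain ⟨x, hx⟩ := Finset.card_pos.1 (by omega : 0 < A.card)
    have := (mem_pathFamily.1 hA).1 x hx
    omega
  | 1, s + 1 => by
    have key : ∀ A ∈ pathFamily 1 (s + 1), A = {0} := fun A hA => by
      obtain ⟨h1, h2, -⟩ := mem_pathFamily.1 hA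
      refine Finset.eq_singleton_iff_nonempty_unique_mem.2
        ⟨Finset.card_pos.1 (by omega), fun x hx => by have := h1 x hx; omega⟩
    refine .of_card_le_one (Finset.card_le_one.2 fun A hA B hB => ?_)
    rw [key A hA, key B hB]
  | M + 2, s + 1 => by
    have hlt : ∀ {M s : ℕ} {A : Finset ℕ} {x : ℕ}, A ∈ pathFamily M s → M ≤ x → x ∉ A :=
      fun h hx hxA => by have := (mem_pathFamily.1 h).1 _ hxA; omega
    have hone : ∀ {A : Finset ℕ}, A ∈ (pathFamily M s).image (insert (M + 1)) ↔
        A ∈ pathFamily (M + 2) (s + 1) ∧ M + 1 ∈ A ∧ ∀ x ∈ A, x ≤ M + 1 :=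
      mem_image_insert_pathFamily (by omega) (by omega) (by omega)
    rw [pathFamily_add_two]
    have step1 : ShellExt ∅ ((pathFamily M s).image (insert (M + 1))) := by
      have := (shellExt_pathFamily M s).link (𝓐 := ∅) (v := M + 1) (by simp)
        (fun G hG => hlt hG (by omega)) (by simp)
      simpa using this
    refine (step1.trans (ShellExt.union ?_ ?_)).trans
      ((shellExt_pathFamily (M - 1) s).link ?_ (fun G hG => hlt hG (by omega)) ?_)
    · rw [Finset.disjoint_left]
      intro A hA hA'
      exact hlt hA' (by omega : M ≤ M + 1) (hone.1 hA).2.1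
    · intro F hF A hA hne
      have hFM : M + 1 ∉ F := hlt hF (by omega)
      have hcard : A.card = F.card := by
        rcases Finset.mem_union.1 hA with h | h
        · rw [(mem_pathFamily.1 (hone.1 h).1).2.1, (mem_pathFamily.1 hF).2.1]
        · rw [(mem_pathFamily.1 h).2.1, (mem_pathFamily.1 hF).2.1]
      obtain ⟨v, hv, hvA⟩ : ∃ v ∈ F, v ∉ A := by
        by_contra! hcon
        exact hne (Finset.eq_of_subset_of_card_le hcon hcard.le).symm
      refine ⟨insert (M + 1) (F.erase v), Finset.mem_image_of_mem _ ?_, v, hv, ?_, ?_⟩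
      · obtain ⟨h1, h2, h3⟩ := mem_pathFamily.1 hF
        refine mem_pathFamily.2 ⟨fun x hx => h1 x (Finset.mem_of_mem_erase hx), ?_,
          fun x hx hx1 => h3 x (Finset.mem_of_mem_erase hx) (Finset.mem_of_mem_erase hx1)⟩
        rw [Finset.card_erase_of_mem hv, h2]; rfl
      · intro x hx
        obtain ⟨h1, h2⟩ := Finset.mem_inter.1 hx
        simp only [Finset.mem_inter, Finset.mem_insert, Finset.mem_erase]
        exact ⟨Or.inr ⟨fun h => hvA (h ▸ h1), h2⟩, h2⟩
      · ext x
        simp only [Finset.mem_inter, Finset.mem_insert, Finset.mem_erase, Finset.mem_sdiff,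
          Finset.mem_singleton]
        constructor
        · rintro ⟨rfl | h, h2⟩
          · exact absurd h2 hFM
          · exact ⟨h2, h.1⟩
        · rintro ⟨h1, h2⟩
          exact ⟨Or.inr ⟨h2, h1⟩, h1⟩
    · intro A hA hMA
      rcases Finset.mem_union.1 hA with h | h
      · obtain ⟨h1, h2, -⟩ := hone.1 h
        exact (mem_pathFamily.1 h1).2.2 M hMA h2
      · exact hlt h le_rfl hMA
    · intro A _ G hG
      refine ⟨insert (M + 1) G, Finset.mem_union_left _ (Finset.mem_image_of_mem _ ?_),
        Finset.subset_insert _ _⟩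
      obtain ⟨h1, h2, h3⟩ := mem_pathFamily.1 hG
      exact mem_pathFamily.2 ⟨fun x hx => by have := h1 x hx; omega, h2, h3⟩

/-- `S` is a set of pairwise nonadjacent vertices of the cycle `0, …, N - 1`. -/
structure CycleIndep (N : ℕ) (S : Finset ℕ) : Prop where
  lt : ∀ x ∈ S, x < N
  succ : ∀ x ∈ S, x + 1 ∉ S
  wrap : ¬ (0 ∈ S ∧ N - 1 ∈ S)

theorem CycleIndep.mono {N : ℕ} {S T : Finset ℕ} (h : CycleIndep N S) (hT : T ⊆ S) :
    CycleIndep N T :=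
  ⟨fun x hx => h.lt x (hT hx), fun x hx hx1 => h.succ x (hT hx) (hT hx1),
    fun hw => h.wrap ⟨hT hw.1, hT hw.2⟩⟩

/-- Each vertex of `S` blocks only itself and its two neighbours, and `T` blocks its own elements.
-/
theorem CycleIndep.exists_insert {N : ℕ} (hN : 2 ≤ N) {S : Finset ℕ} (h : CycleIndep N S)
    (T : Finset ℕ) (hT : 3 * S.card + T.card < N) :
    ∃ w, w ∉ S ∧ w ∉ T ∧ CycleIndep N (insert w S) := by
  let f : ℕ → ℕ := fun x => if x + 1 = N then 0 else x + 1
  let g : ℕ → ℕ := fun x => if x = 0 then N - 1 else x - 1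
  have hcard : (((S ∪ S.image f) ∪ S.image g) ∪ T).card < (Finset.range N).card := by
    have h1 := Finset.card_union_le ((S ∪ S.image f) ∪ S.image g) T
    have h2 := Finset.card_union_le (S ∪ S.image f) (S.image g)
    have h3 := Finset.card_union_le S (S.image f)
    have h4 := Finset.card_image_le (s := S) (f := f)
    have h5 := Finset.card_image_le (s := S) (f := g)
    rw [Finset.card_range]
    omega
  obtain ⟨w, hwN, hw⟩ := Finset.exists_mem_notMem_of_card_lt_card hcard
  rw [Finset.mem_range] at hwN
  simp only [Finset.mem_union, Finset.mem_image, not_or, not_exists, not_and] at hw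
  obtain ⟨⟨⟨h1, h2⟩, h3⟩, h4⟩ := hw
  refine ⟨w, h1, h4, ?_, ?_, ?_⟩
  · intro x hx
    rcases Finset.mem_insert.1 hx with rfl | hx
    · exact hwN
    · exact h.lt x hx
  · intro x hx hx1
    rcases Finset.mem_insert.1 hx with rfl | hx <;> rcases Finset.mem_insert.1 hx1 with he | hx1
    · omega
    · exact h3 _ hx1 (by simp [g])
    · have := h2 x hx
      simp only [f] at this
      split_ifs at this <;> omega
    · exact h.succ x hx hx1
  · rintro ⟨ha, hb⟩
    rcases Finset.mem_insert.1 ha with rfl | ha <;> rcases Finset.mem_insert.1 hb with he | hb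
    · omega
    · have := h2 _ hb
      simp only [f] at this
      split_ifs at this <;> omega
    · have := h3 _ ha
      simp only [g] at this
      split_ifs at this <;> omega
    · exact h.wrap ⟨ha, hb⟩

theorem CycleIndep.exists_superset {N t : ℕ} (hN : 2 ≤ N) (ht : 3 * t < N + 3) {S : Finset ℕ}
    (h : CycleIndep N S) (hS : S.card ≤ t) :
    ∃ T, S ⊆ T ∧ T.card = t ∧ CycleIndep N T := by
  induction t with
  | zero => exact ⟨S, subset_rfl, by omega, h⟩
  | succ t ih =>
    rcases Nat.lt_or_ge t S.card with hlt | hle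
    · exact ⟨S, subset_rfl, by omega, h⟩
    · obtain ⟨T, hST, hT, hTi⟩ := ih (by omega) hle
      obtain ⟨w, hw, -, hwi⟩ := hTi.exists_insert hN ∅ (by simp; omega)
      exact ⟨insert w T, hST.trans (Finset.subset_insert _ _),
        by rw [Finset.card_insert_of_notMem hw, hT], hwi⟩

/-- Sets avoiding the last vertex are independent in a path; those containing it correspond to
independent sets of the path left after deleting it and its two neighbours. To append the second
class, a set of size t must extend to one of size t + 1 avoiding the last vertex: at most 3t + 1
vertices are forbidden, fewer than N. -/
theorem exists_shellExt_cycle {N t : ℕ} (hN : 3 ≤ N) (ht : 3 * t + 2 ≤ N) :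
    ∃ 𝓕 : Finset (Finset ℕ), ShellExt ∅ 𝓕 ∧
      ∀ S, S ∈ 𝓕 ↔ CycleIndep N S ∧ S.card = t + 1 := by
  obtain ⟨N, rfl⟩ := Nat.exists_eq_add_of_le' hN
  have hlink : ShellExt ∅ ((pathFamily N t).image (Finset.image Nat.succ)) :=
    (shellExt_pathFamily N t).image (U := Set.univ) Nat.succ_injective.injOn (by simp)
  have hmem : ∀ G, G ∈ (pathFamily N t).image (Finset.image Nat.succ) ↔
      (∀ x ∈ G, 1 ≤ x ∧ x ≤ N) ∧ G.card = t ∧ ∀ x ∈ G, x + 1 ∉ G := by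
    intro G
    rw [Finset.mem_image]
    constructor
    · rintro ⟨S, hS, rfl⟩
      obtain ⟨h1, h2, h3⟩ := mem_pathFamily.1 hS
      refine ⟨?_, by rw [Finset.card_image_of_injective _ Nat.succ_injective, h2], ?_⟩
      · intro x hx
        obtain ⟨y, hy, rfl⟩ := Finset.mem_image.1 hx
        have := h1 y hy
        omega
      · intro x hx hx1
        obtain ⟨y, hy, rfl⟩ := Finset.mem_image.1 hx
        obtain ⟨y', hy', he⟩ := Finset.mem_image.1 hx1
        obtain rfl : y' = y + 1 := by omega
        exact h3 y hy hy'
    · rintro ⟨h1, h2, h3⟩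
      have hG : (G.image Nat.pred).image Nat.succ = G := by
        rw [Finset.image_image]
        conv_rhs => rw [← Finset.image_id (s := G)]
        refine Finset.image_congr fun x hx => ?_
        exact Nat.succ_pred_eq_of_pos (h1 x hx).1
      refine ⟨G.image Nat.pred, mem_pathFamily.2 ⟨?_, ?_, ?_⟩, hG⟩
      · intro x hx
        obtain ⟨y, hy, rfl⟩ := Finset.mem_image.1 hx
        have := h1 y hy
        simp only [Nat.pred_eq_sub_one]
        omega
      · rw [← h2, ← Finset.card_image_of_injective (G.image Nat.pred) Nat.succ_injective, hG]
      · intro x hx hx1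
        have e1 : x + 1 ∈ G := hG ▸ Finset.mem_image_of_mem Nat.succ hx
        have e2 : x + 1 + 1 ∈ G := hG ▸ Finset.mem_image_of_mem Nat.succ hx1
        exact h3 _ e1 e2
  have hlast : ∀ G ∈ (pathFamily N t).image (Finset.image Nat.succ), N + 2 ∉ G := fun G hG h => by
    have := ((hmem G).1 hG).1 _ h
    omega
  have hcyc : ∀ G, (∀ x ∈ G, 1 ≤ x ∧ x ≤ N) → (∀ x ∈ G, x + 1 ∉ G) →
      CycleIndep (N + 3) (insert (N + 2) G) := by
    intro G h1 h2
    refine ⟨?_, ?_, ?_⟩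
    · intro x hx
      rcases Finset.mem_insert.1 hx with rfl | hx
      · omega
      · have := h1 x hx; omega
    · intro x hx hx1
      rcases Finset.mem_insert.1 hx with rfl | hx <;> rcases Finset.mem_insert.1 hx1 with he | hx1
      · omega
      · have := h1 _ hx1; omega
      · have := h1 x hx; omega
      · exact h2 x hx hx1
    · rintro ⟨h0, -⟩
      rcases Finset.mem_insert.1 h0 with h0 | h0
      · omega
      · have := h1 0 h0; omega
  refine ⟨pathFamily (N + 2) (t + 1) ∪
    ((pathFamily N t).image (Finset.image Nat.succ)).image (insert (N + 2)),
    (shellExt_pathFamily _ _).trans (hlink.link ?_ hlast ?_), ?_⟩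
  · intro A hA h
    have := (mem_pathFamily.1 hA).1 _ h
    omega
  · intro A _ G hG
    obtain ⟨h1, h2, h3⟩ := (hmem G).1 hG
    obtain ⟨w, hw, hw', hwi⟩ := ((hcyc G h1 h3).mono (Finset.subset_insert _ _)).exists_insert
      (by omega) {N + 2} (by rw [h2, Finset.card_singleton]; omega)
    refine ⟨insert w G, mem_pathFamily.2 ⟨fun x hx => ?_, ?_, hwi.succ⟩, Finset.subset_insert _ _⟩
    · have := hwi.lt x hx
      rcases Finset.mem_insert.1 hx with rfl | hx
      · have : x ≠ N + 2 := by simpa using hw'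
        omega
      · have := h1 x hx; omega
    · rw [Finset.card_insert_of_notMem hw, h2]
  · intro S
    rw [Finset.mem_union, Finset.mem_image]
    constructor
    · rintro (h | ⟨G, hG, rfl⟩)
      · obtain ⟨h1, h2, h3⟩ := mem_pathFamily.1 h
        refine ⟨⟨fun x hx => by have := h1 x hx; omega, h3, fun hw => ?_⟩, h2⟩
        have := h1 _ hw.2
        omega
      · have hl := hlast G hG
        obtain ⟨h1, h2, h3⟩ := (hmem G).1 hG
        exact ⟨hcyc G h1 h3, by rw [Finset.card_insert_of_notMem hl, h2]⟩
    · rintro ⟨h, hc⟩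
      by_cases hl : N + 2 ∈ S
      · refine Or.inr ⟨S.erase (N + 2), (hmem _).2 ⟨?_, ?_, ?_⟩, Finset.insert_erase hl⟩
        · intro x hx
          obtain ⟨hne, hx⟩ := Finset.mem_erase.1 hx
          have h1 := h.lt x hx
          have h2 : x ≠ N + 1 := fun he => h.succ x hx (he ▸ hl)
          have h3 : x ≠ 0 := fun he => h.wrap ⟨he ▸ hx, hl⟩
          omega
        · rw [Finset.card_erase_of_mem hl, hc]; rfl
        · intro x hx hx1
          exact h.succ x (Finset.mem_of_mem_erase hx) (Finset.mem_of_mem_erase hx1)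
      · refine Or.inl (mem_pathFamily.2 ⟨fun x hx => ?_, hc, h.succ⟩)
        have h1 := h.lt x hx
        have h2 : x ≠ N + 2 := fun he => hl (he ▸ hx)
        omega

end Families

end TreeComplex

namespace TreeComplex

/-! ### Vanishing of mod 2 homology below the top dimension of a shelling -/

section Homology

variable {α : Type*} [DecidableEq α]

/-- The square of the boundary is zero: the two orders of adding x and y cancel mod 2. -/
theorem sum_sum_insert_insert (U E : Finset α) (w : Finset α → ZMod 2) :
    ∑ x ∈ U \ E, ∑ y ∈ U \ insert x E, w (insert y (insert x E)) = 0 := by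
  rw [Finset.sum_sigma']
  refine Finset.sum_involution (fun p _ => ⟨p.2, p.1⟩) ?_ ?_ ?_ ?_
  · rintro ⟨x, y⟩ _
    dsimp only
    rw [Finset.insert_comm]
    exact CharTwo.add_self_eq_zero _
  · rintro ⟨x, y⟩ h _ he
    simp only [Finset.mem_sigma, Finset.mem_sdiff, Finset.mem_insert, not_or] at h
    simp only [Sigma.mk.injEq] at he
    exact h.2.2.1 he.1
  · rintro ⟨x, y⟩ h
    simp only [Finset.mem_sigma, Finset.mem_sdiff, Finset.mem_insert, not_or] at h ⊢
    exact ⟨⟨h.2.1, h.2.2.2⟩, h.1.1, fun e => h.2.2.1 e.symm, h.1.2⟩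
  · rintro ⟨x, y⟩ _
    rfl

/-- Coboundary and boundary are adjoint for the pairing of cochains with chains. -/
theorem sum_mul_sum_insert (U : Finset α) (c w : Finset α → ZMod 2) :
    ∑ A ∈ U.powerset, c A * ∑ x ∈ U \ A, w (insert x A) =
      ∑ B ∈ U.powerset, (∑ x ∈ B, c (B.erase x)) * w B := by
  simp only [Finset.mul_sum, Finset.sum_mul]
  rw [Finset.sum_sigma', Finset.sum_sigma']
  refine Finset.sum_bij' (fun p _ => ⟨insert p.2 p.1, p.2⟩) (fun p _ => ⟨p.1.erase p.2, p.2⟩)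
    ?_ ?_ ?_ ?_ ?_
  · rintro ⟨A, x⟩ h
    simp only [Finset.mem_sigma, Finset.mem_powerset, Finset.mem_sdiff] at h ⊢
    exact ⟨Finset.insert_subset h.2.1 h.1, Finset.mem_insert_self _ _⟩
  · rintro ⟨B, x⟩ h
    simp only [Finset.mem_sigma, Finset.mem_powerset, Finset.mem_sdiff] at h ⊢
    exact ⟨(Finset.erase_subset _ _).trans h.1, h.1 h.2, Finset.notMem_erase _ _⟩
  · rintro ⟨A, x⟩ h
    simp only [Finset.mem_sigma, Finset.mem_sdiff] at h
    simp [Finset.erase_insert h.2.2]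
  · rintro ⟨B, x⟩ h
    simp only [Finset.mem_sigma] at h
    simp [Finset.insert_erase h.2]
  · rintro ⟨A, x⟩ h
    simp only [Finset.mem_sigma, Finset.mem_sdiff] at h
    simp [Finset.erase_insert h.2.2]

/-- In a shellable complex whose facets have more than `t` elements, every cocycle modulo 2
vanishes on every cycle modulo 2 that is supported on faces with at most `t` elements. -/
theorem sum_cocycle_mul_cycle_eq_zero {m : ℕ} {F : Fin m → Finset α} {U : Finset α}
    (hFU : ∀ i, F i ⊆ U)
    (hsh : ∀ i j : Fin m, i < j → ∃ l : Fin m, l < j ∧ ∃ v ∈ F j,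
      F i ∩ F j ⊆ F l ∩ F j ∧ F l ∩ F j = F j \ {v})
    {t : ℕ} (hcard : ∀ i, t < (F i).card) {c : Finset α → ZMod 2}
    (hc : ∀ B, (∃ i, B ⊆ F i) → ∑ x ∈ B, c (B.erase x) = 0) (k : ℕ) :
    ∀ z : Finset α → ZMod 2,
      (∀ A, z A ≠ 0 → A.card ≤ t ∧ ∃ i : Fin m, i.val < k ∧ A ⊆ F i) →
      (∀ E, ∑ x ∈ U \ E, z (insert x E) = 0) → ∑ A ∈ U.powerset, c A * z A = 0 := by
  induction k with
  | zero =>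
    intro z hz _
    refine Finset.sum_eq_zero fun A _ => ?_
    have : z A = 0 := by
      by_contra h
      obtain ⟨-, i, hi, -⟩ := hz A h
      exact absurd hi (Nat.not_lt_zero _)
    rw [this, mul_zero]
  | succ k ih =>
    intro z hz hcyc
    by_cases hkm : k < m
    swap
    · refine ih z (fun A hA => ?_) hcyc
      obtain ⟨h1, i, -, h2⟩ := hz A hA
      exact ⟨h1, i, by have := i.isLt; omega, h2⟩
    obtain ⟨j, hj⟩ : ∃ j : Fin m, j.val = k := ⟨⟨k, hkm⟩, rfl⟩
    classical
    -- The restriction set of `F j`: the faces of `F j` lying in no earlier facet are exactly those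
    -- containing `R`.
    let R : Finset α := (F j).filter fun v => ∃ l, l < j ∧ F l ∩ F j = F j \ {v}
    have hRF : R ⊆ F j := Finset.filter_subset _ _
    have hRold : ∀ i < j, ¬ R ⊆ F i := by
      intro i hi hR
      obtain ⟨l, hl, v, hv, h1, h2⟩ := hsh i j hi
      have hvR : v ∈ R := Finset.mem_filter.2 ⟨hv, l, hl, h2⟩
      have := h1 (Finset.mem_inter.2 ⟨hR hvR, hv⟩)
      rw [h2] at this
      simp at this
    have hnew : ∀ A, A ⊆ F j → (¬ ∃ i : Fin m, i.val < k ∧ A ⊆ F i) → R ⊆ A := by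
      intro A hA hno v hv
      by_contra hvA
      obtain ⟨hvF, l, hl, h2⟩ := Finset.mem_filter.1 hv
      refine hno ⟨l, by rw [← hj]; exact hl, fun x hx => ?_⟩
      have : x ∈ F l ∩ F j := by
        rw [h2]
        exact Finset.mem_sdiff.2 ⟨hA hx, fun h => hvA (Finset.mem_singleton.1 h ▸ hx)⟩
      exact (Finset.mem_inter.1 this).1
    have hsplit : ∀ {A : Finset α}, (∃ i : Fin m, i.val < k + 1 ∧ A ⊆ F i) →
        (¬ ∃ i : Fin m, i.val < k ∧ A ⊆ F i) → A ⊆ F j := by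
      rintro A ⟨i, hi, hA⟩ hno
      have : i = j := by
        by_contra hne
        have : i.val ≠ j.val := fun h => hne (Fin.ext h)
        exact hno ⟨i, by omega, hA⟩
      exact this ▸ hA
    -- In this case `F j` is the only new face, and it is too large to support `z`.
    by_cases hR : F j ⊆ R
    · refine ih z (fun A hA => ?_) hcyc
      obtain ⟨h1, h2⟩ := hz A hA
      refine ⟨h1, ?_⟩
      by_contra hno
      have := Finset.card_le_card (hR.trans (hnew A (hsplit h2 hno) hno))
      have := hcard j
      omega
    obtain ⟨u, huF, huR⟩ := Finset.not_subset.1 hR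
    -- Toggling `u` matches the new faces in pairs. Adding the boundary of `w` to `z` cancels `z` on
    -- the new faces that miss `u`.
    let w : Finset α → ZMod 2 := fun B =>
      if u ∈ B ∧ R ⊆ B ∧ B ⊆ F j then z (B.erase u) else 0
    have hw : ∀ B, w B ≠ 0 → u ∈ B ∧ B ⊆ F j ∧ B.card ≤ t + 1 := by
      intro B hB
      by_cases h : u ∈ B ∧ R ⊆ B ∧ B ⊆ F j
      · simp only [w, if_pos h] at hB
        have := (hz _ hB).1
        rw [Finset.card_erase_of_mem h.1] at this
        exact ⟨h.1, h.2.2, by omega⟩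
      · simp only [w, if_neg h, ne_eq, not_true] at hB
    let z' : Finset α → ZMod 2 := fun A => z A + ∑ x ∈ U \ A, w (insert x A)
    have hcyc' : ∀ E, ∑ x ∈ U \ E, z' (insert x E) = 0 := by
      intro E
      simp only [z', Finset.sum_add_distrib]
      rw [hcyc, sum_sum_insert_insert, add_zero]
    have hsupp : ∀ A, z' A ≠ 0 → A.card ≤ t ∧ ∃ i : Fin m, i.val < k + 1 ∧ A ⊆ F i := by
      intro A hA
      by_cases hzA : z A = 0
      · simp only [z', hzA, zero_add] at hA
        obtain ⟨x, hx, hwx⟩ := Finset.exists_ne_zero_of_sum_ne_zero hA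
        obtain ⟨-, h1, h2⟩ := hw _ hwx
        rw [Finset.card_insert_of_notMem (Finset.mem_sdiff.1 hx).2] at h2
        exact ⟨by omega, j, by omega, (Finset.subset_insert _ _).trans h1⟩
      · exact hz A hzA
    have hzero : ∀ A, R ⊆ A → u ∉ A → z' A = 0 := by
      intro A hRA huA
      by_contra hne
      have hAF : A ⊆ F j := by
        refine hsplit (hsupp A hne).2 ?_
        rintro ⟨i, hi, hAi⟩
        exact hRold i (by rw [Fin.lt_def]; omega) (hRA.trans hAi)
      refine hne ?_
      have : ∑ x ∈ U \ A, w (insert x A) = z A := by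
        rw [Finset.sum_eq_single_of_mem u (Finset.mem_sdiff.2 ⟨hFU j huF, huA⟩)]
        · have hcond : u ∈ insert u A ∧ R ⊆ insert u A ∧ insert u A ⊆ F j :=
            ⟨Finset.mem_insert_self _ _, hRA.trans (Finset.subset_insert _ _),
              Finset.insert_subset huF hAF⟩
          simp only [w, if_pos hcond, Finset.erase_insert huA]
        · intro x _ hxu
          by_contra hwx
          rcases Finset.mem_insert.1 (hw _ hwx).1 with h | h
          · exact hxu h.symm
          · exact huA h
      simp only [z', this]
      exact CharTwo.add_self_eq_zero _
    have hold : ∀ A, z' A ≠ 0 → A.card ≤ t ∧ ∃ i : Fin m, i.val < k ∧ A ⊆ F i := by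
      intro A hA
      refine ⟨(hsupp A hA).1, ?_⟩
      by_contra hno
      have hAF := hsplit (hsupp A hA).2 hno
      have hRA := hnew A hAF hno
      have huA : u ∈ A := by
        by_contra h
        exact hA (hzero A hRA h)
      have hRE : R ⊆ A.erase u := fun x hx =>
        Finset.mem_erase.2 ⟨fun h => huR (h ▸ hx), hRA hx⟩
      -- In the cycle condition at `A.erase u`, every term other than that of `u` belongs to a set
      -- containing `R` and missing `u`, hence vanishes; so `z' A = 0` as well.
      have hsum := hcyc' (A.erase u)
      rw [Finset.sum_eq_single_of_mem u
        (Finset.mem_sdiff.2 ⟨hFU j huF, Finset.notMem_erase _ _⟩), Finset.insert_erase huA] at hsum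
      · exact hA hsum
      · intro x _ hxu
        refine hzero _ (hRE.trans (Finset.subset_insert _ _)) fun h => ?_
        rcases Finset.mem_insert.1 h with h | h
        · exact hxu h.symm
        · exact Finset.notMem_erase _ _ h
    have hsum := ih z' hold hcyc'
    -- Passing from `z` to `z'` does not change the pairing with `c`: by adjointness the difference
    -- pairs the coboundary of `c` with `w`, and that coboundary is zero on subsets of `F j`.
    simp only [z', mul_add, Finset.sum_add_distrib] at hsum
    rw [sum_mul_sum_insert] at hsum
    have hzw : ∑ B ∈ U.powerset, (∑ x ∈ B, c (B.erase x)) * w B = 0 := by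
      refine Finset.sum_eq_zero fun B _ => ?_
      by_cases hwB : w B = 0
      · rw [hwB, mul_zero]
      · rw [hc B ⟨j, (hw B hwB).2.1⟩, zero_mul]
    rwa [hzw, add_zero] at hsum

end Homology

/-! ### A cocycle and a cycle on the independent sets of a cycle of length 3t + 1 -/

section Cycle

/-- The set `{1, 4, …, 3 i - 2} ∪ {3 i + 3, 3 i + 6, …, 3 t}`. -/
def shiftedSet (t i : ℕ) : Finset ℕ :=
  (Finset.range (3 * t + 1)).filter fun x => (x ≤ 3 * i ∧ x % 3 = 1) ∨ (3 * i < x ∧ x % 3 = 0)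

theorem mem_shiftedSet {t i x : ℕ} : x ∈ shiftedSet t i ↔
    x < 3 * t + 1 ∧ ((x ≤ 3 * i ∧ x % 3 = 1) ∨ (3 * i < x ∧ x % 3 = 0)) := by
  simp [shiftedSet]

/-- The only vertices that can be added to the i-th shifted set are 3i (if i ≥ 1) and 3i + 1 (if i <
t), both in its widest gap. The enlarged set then contains the shifted set with index i - 1 or i +
1, respectively. -/
theorem CycleIndep.erase_eq_shiftedSet {t i x : ℕ} (ht : 1 ≤ t) {B : Finset ℕ}
    (hB : CycleIndep (3 * t + 1) B) (hi : i ≤ t) (hx : x ∈ B) (h : B.erase x = shiftedSet t i) :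
    (x = 3 * i ∧ 1 ≤ i ∧ x - 2 ∈ B ∧ B.erase (x - 2) = shiftedSet t (i - 1)) ∨
      (x = 3 * i + 1 ∧ i < t ∧ x + 2 ∈ B ∧ B.erase (x + 2) = shiftedSet t (i + 1)) := by
  have hmem : ∀ y, y ∈ B ↔ y = x ∨ y ∈ shiftedSet t i := by
    intro y
    rw [← h, Finset.mem_erase]
    by_cases hyx : y = x
    · simp [hyx, hx]
    · simp [hyx]
  have hxN := hB.lt x hx
  have hxs : x ∉ shiftedSet t i := h ▸ Finset.notMem_erase _ _
  have hx1 : x + 1 ∉ shiftedSet t i := fun h' => hB.succ x hx ((hmem _).2 (Or.inr h'))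
  have hx2 : 1 ≤ x → x - 1 ∉ shiftedSet t i := fun h1 h' => by
    refine hB.succ (x - 1) ((hmem _).2 (Or.inr h')) ?_
    rwa [Nat.sub_add_cancel h1]
  have hx3 : x = 0 → 3 * t ∉ shiftedSet t i := fun h0 h' =>
    hB.wrap ⟨h0 ▸ hx, (hmem _).2 (Or.inr h')⟩
  rw [mem_shiftedSet] at hxs hx1 hx2 hx3
  have hcase : (x = 3 * i ∧ 1 ≤ i) ∨ (x = 3 * i + 1 ∧ i < t) := by omega
  rcases hcase with ⟨h1, h2⟩ | ⟨h1, h2⟩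
  · refine Or.inl ⟨h1, h2, ?_, ?_⟩
    · rw [hmem, mem_shiftedSet]; omega
    · ext y
      rw [Finset.mem_erase, hmem, mem_shiftedSet, mem_shiftedSet]
      omega
  · refine Or.inr ⟨h1, h2, ?_, ?_⟩
    · rw [hmem, mem_shiftedSet]; omega
    · ext y
      rw [Finset.mem_erase, hmem, mem_shiftedSet, mem_shiftedSet]
      omega

open Classical in
/-- The indicator function of the sets `shiftedSet t i` for `i ≤ t`. -/
noncomputable def shiftedCochain (t : ℕ) (A : Finset ℕ) : ZMod 2 :=
  if ∃ i ≤ t, A = shiftedSet t i then 1 else 0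

/-- The nonzero terms cancel in pairs: an independent set one element larger than a shifted set
contains two consecutive shifted sets, obtained by erasing 3i and 3i - 2 for some i. -/
theorem shiftedCochain_cocycle {t : ℕ} (ht : 1 ≤ t) {B : Finset ℕ}
    (hB : CycleIndep (3 * t + 1) B) : ∑ x ∈ B, shiftedCochain t (B.erase x) = 0 := by
  have hne : ∀ {A}, shiftedCochain t A ≠ 0 → ∃ i ≤ t, A = shiftedSet t i := fun {A} h => by
    by_contra hcon
    exact h (if_neg hcon)
  have hone : ∀ {A} i, i ≤ t → A = shiftedSet t i → shiftedCochain t A = 1 :=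
    fun i hi h => if_pos ⟨i, hi, h⟩
  rw [← Finset.sum_filter_ne_zero]
  refine Finset.sum_involution (fun x _ => if x % 3 = 1 then x + 2 else x - 2) ?_ ?_ ?_ ?_
  · intro x hx
    obtain ⟨hxB, hx0⟩ := Finset.mem_filter.1 hx
    obtain ⟨i, hi, h⟩ := hne hx0
    rw [hone i hi h]
    rcases hB.erase_eq_shiftedSet ht hi hxB h with ⟨rfl, h1, h2, h3⟩ | ⟨rfl, h1, h2, h3⟩
    · rw [if_neg (by omega), hone (i - 1) (by omega) h3]; rfl
    · rw [if_pos (by omega), hone (i + 1) (by omega) h3]; rfl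
  · intro x hx _
    obtain ⟨hxB, hx0⟩ := Finset.mem_filter.1 hx
    obtain ⟨i, hi, h⟩ := hne hx0
    rcases hB.erase_eq_shiftedSet ht hi hxB h with ⟨rfl, h1, -, -⟩ | ⟨rfl, h1, -, -⟩ <;>
      split_ifs <;> omega
  · intro x hx
    obtain ⟨hxB, hx0⟩ := Finset.mem_filter.1 hx
    obtain ⟨i, hi, h⟩ := hne hx0
    rcases hB.erase_eq_shiftedSet ht hi hxB h with ⟨rfl, h1, h2, h3⟩ | ⟨rfl, h1, h2, h3⟩
    · rw [if_neg (by omega), Finset.mem_filter, hone (i - 1) (by omega) h3]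
      exact ⟨h2, one_ne_zero⟩
    · rw [if_pos (by omega), Finset.mem_filter, hone (i + 1) (by omega) h3]
      exact ⟨h2, one_ne_zero⟩
  · intro x hx
    obtain ⟨hxB, hx0⟩ := Finset.mem_filter.1 hx
    obtain ⟨i, hi, h⟩ := hne hx0
    rcases hB.erase_eq_shiftedSet ht hi hxB h with ⟨rfl, h1, -, -⟩ | ⟨rfl, h1, -, -⟩ <;>
      split_ifs <;> omega

/-- `A` contains exactly one of `3 i + 1` and `3 i + 2` for each `i < t`, and nothing else. -/
def IsTransversal (t : ℕ) (A : Finset ℕ) : Prop :=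
  (∀ x ∈ A, x < 3 * t ∧ x % 3 ≠ 0) ∧ ∀ i < t, (3 * i + 1 ∈ A ↔ 3 * i + 2 ∉ A)

theorem IsTransversal.cycleIndep {t : ℕ} {A : Finset ℕ} (h : IsTransversal t A) :
    CycleIndep (3 * t + 1) A := by
  refine ⟨fun x hx => by have := (h.1 x hx).1; omega, fun x hx hx1 => ?_, fun hw => ?_⟩
  · have h1 := h.1 x hx
    have h2 := h.1 _ hx1
    have h3 := h.2 (x / 3) (by omega)
    rw [show 3 * (x / 3) + 1 = x by omega, show 3 * (x / 3) + 2 = x + 1 by omega] at h3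
    exact h3.1 hx hx1
  · exact (h.1 0 hw.1).2 rfl

theorem IsTransversal.card_le {t : ℕ} {A : Finset ℕ} (h : IsTransversal t A) : A.card ≤ t := by
  rw [← Finset.card_range t]
  refine Finset.card_le_card_of_injOn (fun x => x / 3) (fun x hx => ?_) fun x hx y hy hxy => ?_
  · have := (h.1 x hx).1
    simp only [Finset.coe_range, Set.mem_Iio]
    omega
  · simp only at hxy
    have hx' := h.1 x hx
    have hy' := h.1 y hy
    by_contra hne
    rcases lt_or_gt_of_ne hne with hlt | hlt
    · exact h.cycleIndep.succ x hx ((show x + 1 = y by omega) ▸ hy)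
    · exact h.cycleIndep.succ y hy ((show y + 1 = x by omega) ▸ hx)

theorem IsTransversal.swap {t x y : ℕ} {E : Finset ℕ} (hx : x ∉ E)
    (h : IsTransversal t (insert x E)) (hxy : x / 3 = y / 3) (hne : x ≠ y) (hy : y % 3 ≠ 0) :
    y ∉ E ∧ IsTransversal t (insert y E) := by
  have hxl := h.1 x (Finset.mem_insert_self _ _)
  have hyE : y ∉ E := fun hyE => by
    have h2 := h.2 (x / 3) (by omega)
    have hxm : x ∈ insert x E := Finset.mem_insert_self _ _
    have hym : y ∈ insert x E := Finset.mem_insert_of_mem hyE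
    have : (x = 3 * (x / 3) + 1 ∧ y = 3 * (x / 3) + 2) ∨
      (y = 3 * (x / 3) + 1 ∧ x = 3 * (x / 3) + 2) := by omega
    rcases this with ⟨h3, h4⟩ | ⟨h3, h4⟩
    · rw [← h3, ← h4] at h2
      exact h2.1 hxm hym
    · rw [← h3, ← h4] at h2
      exact h2.1 hym hxm
  refine ⟨hyE, fun v hv => ?_, fun i hi => ?_⟩
  · rcases Finset.mem_insert.1 hv with rfl | hv
    · exact ⟨by omega, hy⟩
    · exact h.1 v (Finset.mem_insert_of_mem hv)
  · have h2 := h.2 i hi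
    simp only [Finset.mem_insert] at h2 ⊢
    by_cases hix : i = x / 3
    · have : (x = 3 * i + 1 ∧ y = 3 * i + 2) ∨ (y = 3 * i + 1 ∧ x = 3 * i + 2) := by omega
      rcases this with ⟨h3, h4⟩ | ⟨h3, h4⟩
      · rw [← h3, ← h4]
        simp [hx, hyE, hne]
      · rw [← h3, ← h4]
        simp [hx, hyE, hne]
    · have e1 : 3 * i + 1 ≠ x := by omega
      have e2 : 3 * i + 2 ≠ x := by omega
      have e3 : 3 * i + 1 ≠ y := by omega
      have e4 : 3 * i + 2 ≠ y := by omega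
      simpa [e1, e2, e3, e4] using h2

open Classical in
/-- The sum of all transversals. -/
noncomputable def transversalChain (t : ℕ) (A : Finset ℕ) : ZMod 2 :=
  if IsTransversal t A then 1 else 0

/-- Transversals are the facets of a cross-polytope boundary, so swapping 3i + 1 with 3i + 2 pairs
off the two transversals through a given ridge. -/
theorem transversalChain_cycle {t : ℕ} (E : Finset ℕ) :
    ∑ x ∈ Finset.range (3 * t + 1) \ E, transversalChain t (insert x E) = 0 := by
  have hne : ∀ {A}, transversalChain t A ≠ 0 → IsTransversal t A := fun {A} h => by
    by_contra hcon
    exact h (if_neg hcon)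
  have hone : ∀ {A}, IsTransversal t A → transversalChain t A = 1 := fun h => if_pos h
  let g : ℕ → ℕ := fun x => if x % 3 = 1 then x + 1 else x - 1
  have key : ∀ x ∈ (Finset.range (3 * t + 1) \ E).filter
      (fun x => transversalChain t (insert x E) ≠ 0),
      x ∉ E ∧ x % 3 ≠ 0 ∧ x < 3 * t ∧ IsTransversal t (insert x E) ∧
        g x ∉ E ∧ IsTransversal t (insert (g x) E) := by
    intro x hx
    obtain ⟨hx, hx0⟩ := Finset.mem_filter.1 hx
    have hxE := (Finset.mem_sdiff.1 hx).2
    have h := hne hx0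
    have h1 := h.1 x (Finset.mem_insert_self _ _)
    have h2 := h.swap (y := g x) hxE (by simp only [g]; split_ifs <;> omega)
      (by simp only [g]; split_ifs <;> omega) (by simp only [g]; split_ifs <;> omega)
    exact ⟨hxE, h1.2, h1.1, h, h2⟩
  rw [← Finset.sum_filter_ne_zero]
  refine Finset.sum_involution (fun x _ => g x) ?_ ?_ ?_ ?_
  · intro x hx
    obtain ⟨-, -, -, h1, -, h2⟩ := key x hx
    rw [hone h1, hone h2]; rfl
  · intro x hx _
    have := (key x hx).2.1
    simp only [g]
    split_ifs <;> omega
  · intro x hx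
    obtain ⟨-, -, -, h1, h2, h3⟩ := key x hx
    rw [Finset.mem_filter, hone h3, Finset.mem_sdiff, Finset.mem_range]
    have := (h3.1 (g x) (Finset.mem_insert_self _ _)).1
    exact ⟨⟨by omega, h2⟩, one_ne_zero⟩
  · intro x hx
    have := (key x hx).2.1
    simp only [g]
    split_ifs <;> omega

theorem isTransversal_shiftedSet (t : ℕ) : IsTransversal t (shiftedSet t t) := by
  refine ⟨fun x hx => ?_, fun i hi => ?_⟩
  · rw [mem_shiftedSet] at hx
    omega
  · rw [mem_shiftedSet, mem_shiftedSet]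
    omega

/-- Every shifted set with i < t contains 3t, which no transversal does; only i = t contributes. -/
theorem sum_shiftedCochain_mul_transversalChain (t : ℕ) :
    ∑ A ∈ (Finset.range (3 * t + 1)).powerset, shiftedCochain t A * transversalChain t A = 1 := by
  rw [Finset.sum_eq_single_of_mem (shiftedSet t t)
    (Finset.mem_powerset.2 (Finset.filter_subset _ _))]
  · rw [shiftedCochain, if_pos ⟨t, le_rfl, rfl⟩, transversalChain,
      if_pos (isTransversal_shiftedSet t), one_mul]
  · intro A _ hA
    rw [shiftedCochain, transversalChain]
    split_ifs with h1 h2 <;> try simp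
    obtain ⟨i, hi, rfl⟩ := h1
    have hit : i ≠ t := fun h => hA (h ▸ rfl)
    have := (h2.1 (3 * t) (mem_shiftedSet.2 (by omega))).1
    omega

/-- Independent sets of a cycle of length `3 t + 1` that contain all transversals as subsets and
have more than `t` elements cannot be listed in a shelling order. -/
theorem not_shelling_cycle {t m : ℕ} (ht : 1 ≤ t) {G : Fin m → Finset ℕ}
    (hG : ∀ i, CycleIndep (3 * t + 1) (G i)) (hcard : ∀ i, t < (G i).card)
    (htr : ∀ A, IsTransversal t A → ∃ i, A ⊆ G i)
    (hsh : ∀ i j : Fin m, i < j → ∃ l : Fin m, l < j ∧ ∃ v ∈ G j,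
      G i ∩ G j ⊆ G l ∩ G j ∧ G l ∩ G j = G j \ {v}) : False := by
  have h := sum_cocycle_mul_cycle_eq_zero (U := Finset.range (3 * t + 1))
    (fun i x hx => Finset.mem_range.2 ((hG i).lt x hx)) hsh hcard (c := shiftedCochain t)
    (fun B ⟨i, hB⟩ => shiftedCochain_cocycle ht ((hG i).mono hB)) m (transversalChain t)
    (fun A hA => ?_) transversalChain_cycle
  · rw [sum_shiftedCochain_mul_transversalChain] at h
    exact one_ne_zero h
  · have hA' : IsTransversal t A := by
      by_contra hcon
      exact hA (if_neg hcon)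
    obtain ⟨i, hi⟩ := htr A hA'
    exact ⟨hA'.card_le, i, i.isLt, hi⟩

end Cycle

end TreeComplex

namespace TreeComplex

/-! ### Forests in the doubled cycle as independent sets of a cycle of length 2n -/

section CycleGraph

/-- The vertex `b` follows the vertex `a` on the cycle `0, …, n - 1`. -/
def Follows {n : ℕ} (a b : Fin n) : Prop :=
  b.val = a.val + 1 ∨ (a.val + 1 = n ∧ b.val = 0)

theorem cycleGraph_adj_iff_follows {n : ℕ} (hn : 3 ≤ n) (a b : Fin n) :
    (SimpleGraph.cycleGraph n).Adj a b ↔ Follows a b ∨ Follows b a := by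
  have key : ∀ a b : Fin n, (a - b).val = 1 ↔ Follows b a := by
    intro a b
    rw [Fin.val_sub, Follows]
    have := a.isLt
    have := b.isLt
    rcases lt_or_ge (n - b.val + a.val) n with h | h
    · rw [Nat.mod_eq_of_lt h]; omega
    · rw [Nat.mod_eq_sub_mod h, Nat.mod_eq_of_lt (by omega)]; omega
  rw [SimpleGraph.cycleGraph_adj', key, key]
  exact or_comm

theorem exists_notMem_of_card_lt {n : ℕ} {S : Finset ℕ} (hS : S.card < n) {f : ℕ → ℕ}
    (hf : Function.Injective f) : ∃ i < n, f i ∉ S := by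
  by_contra! h
  have : ((Finset.range n).image f).card ≤ S.card :=
    Finset.card_le_card (Finset.image_subset_iff.2 fun i hi => h i (Finset.mem_range.1 hi))
  rw [Finset.card_image_of_injective _ hf, Finset.card_range] at this
  omega

/-- The distance from the successor of `i` to `a` along the cycle. -/
def distFrom {n : ℕ} (i : ℕ) (a : Fin n) : ℕ :=
  if i < a.val then a.val - i - 1 else a.val + n - i - 1

/-- Cutting the cycle open just after `i` turns it into a path, along which every step not leaving
`i` moves forward. -/
theorem distFrom_lt {n : ℕ} {i : ℕ} {a b : Fin n} (h : Follows a b) (ha : a.val ≠ i) (hi : i < n) :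
    distFrom i a < distFrom i b := by
  have := a.isLt
  have := b.isLt
  unfold Follows at h
  unfold distFrom
  split_ifs <;> omega

theorem Follows.left_unique {n : ℕ} {a a' b : Fin n} (h : Follows a b) (h' : Follows a' b) : a = a' := by
  have := a.isLt
  have := a'.isLt
  unfold Follows at h h'
  rw [Fin.ext_iff]
  omega

theorem Follows.right_unique {n : ℕ} {a b b' : Fin n} (h : Follows a b) (h' : Follows a b') : b = b' := by
  have := b.isLt
  have := b'.isLt
  unfold Follows at h h'
  rw [Fin.ext_iff]
  omega

/-- The directed edges of the doubled cycle, in such an order that cyclically consecutive edges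
are exactly those which cannot lie in a common directed forest. -/
def cycleEdge (n : ℕ) [NeZero n] (x : ℕ) : Fin n × Fin n :=
  if x % 2 = 0 then (Fin.ofNat n (x / 2 + 1), Fin.ofNat n (x / 2))
  else (Fin.ofNat n (x / 2), Fin.ofNat n (x / 2 + 1))

variable {n : ℕ} [NeZero n]

theorem cycleEdge_eq_iff {x : ℕ} (hx : x < 2 * n) (a b : Fin n) :
    cycleEdge n x = (a, b) ↔
      (x = 2 * b.val ∧ Follows b a) ∨ (x = 2 * a.val + 1 ∧ Follows a b) := by
  have ha := a.isLt
  have hb := b.isLt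
  have h1 : x / 2 % n = x / 2 := Nat.mod_eq_of_lt (by omega)
  have h2 : ((x / 2 + 1) % n = x / 2 + 1 ∧ x / 2 + 1 < n) ∨
      ((x / 2 + 1) % n = 0 ∧ x / 2 + 1 = n) := by
    rcases lt_or_ge (x / 2 + 1) n with h | h
    · exact Or.inl ⟨Nat.mod_eq_of_lt h, h⟩
    · have : x / 2 + 1 = n := by omega
      exact Or.inr ⟨by rw [this, Nat.mod_self], this⟩
  unfold cycleEdge Follows
  split_ifs with h <;> simp only [Prod.mk.injEq, Fin.ext_iff, Fin.val_ofNat, h1] <;> omega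

theorem cycleEdge_injOn (hn : 3 ≤ n) : Set.InjOn (cycleEdge n) {x | x < 2 * n} := by
  intro x hx y hy h
  obtain ⟨⟨a, b⟩, hab⟩ : ∃ e, cycleEdge n x = e := ⟨_, rfl⟩
  rw [hab] at h
  have h1 := (cycleEdge_eq_iff hx a b).1 hab
  have h2 := (cycleEdge_eq_iff hy a b).1 h.symm
  unfold Follows at h1 h2
  omega

theorem mem_image_cycleEdge {S : Finset ℕ} (hS : ∀ x ∈ S, x < 2 * n) (a b : Fin n) :
    (a, b) ∈ S.image (cycleEdge n) ↔
      (2 * b.val ∈ S ∧ Follows b a) ∨ (2 * a.val + 1 ∈ S ∧ Follows a b) := by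
  rw [Finset.mem_image]
  constructor
  · rintro ⟨x, hx, h⟩
    rcases (cycleEdge_eq_iff (hS x hx) a b).1 h with ⟨rfl, h'⟩ | ⟨rfl, h'⟩
    · exact Or.inl ⟨hx, h'⟩
    · exact Or.inr ⟨hx, h'⟩
  · rintro (⟨hx, h⟩ | ⟨hx, h⟩)
    · exact ⟨_, hx, (cycleEdge_eq_iff (hS _ hx) a b).2 (Or.inl ⟨rfl, h⟩)⟩
    · exact ⟨_, hx, (cycleEdge_eq_iff (hS _ hx) a b).2 (Or.inr ⟨rfl, h⟩)⟩

/-- A walk cannot turn around, because opposite edges have neighbouring numbers. A closed walk would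
thus use all n edges of one parity, but `S` has fewer than n elements and so misses an edge of each
parity; `distFrom` measured from the missing edge is strictly monotone along the walk. -/
theorem CycleIndep.isDirectedForest {S : Finset ℕ} (h : CycleIndep (2 * n) S) (hS : S.card < n) :
    IsDirectedForest (S.image (cycleEdge n) : Set (Fin n × Fin n)) := by
  have hmem := mem_image_cycleEdge h.lt
  rw [isDirectedForest_iff]
  simp only [Finset.mem_coe, IsAcyclic, hmem]
  obtain ⟨i, hi, hiS⟩ := exists_notMem_of_card_lt (n := n) hS (f := fun i => 2 * i)
    fun a b hab => by simpa using hab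
  obtain ⟨j, hj, hjS⟩ := exists_notMem_of_card_lt (n := n) hS (f := fun i => 2 * i + 1)
    fun a b hab => by simpa using hab
  let R : Fin n → Fin n → Prop := fun a b =>
    (2 * b.val ∈ S ∧ Follows b a) ∨ (2 * a.val + 1 ∈ S ∧ Follows a b)
  refine ⟨fun u hu => ?_, fun a a' b hab hab' => ?_⟩
  · obtain ⟨v, huv, hvu⟩ := Relation.TransGen.head'_iff.1 hu
    rcases huv with ⟨hv, hf⟩ | ⟨hv, hf⟩
    · have key : ∀ y, Relation.ReflTransGen R v y →
          ∃ w : Fin n, Follows y w ∧ 2 * y.val ∈ S ∧ distFrom i y < distFrom i u := by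
        intro y hvy
        induction hvy with
        | refl => exact ⟨u, hf, hv, distFrom_lt hf (fun e => hiS (by rwa [← e])) hi⟩
        | tail _ hstep ih =>
          obtain ⟨w, h1, h2, h3⟩ := ih
          rcases hstep with ⟨h4, h5⟩ | ⟨h4, h5⟩
          · exact ⟨_, h5, h4, (distFrom_lt h5 (fun e => hiS (by rwa [← e])) hi).trans h3⟩
          · exact absurd h4 (h.succ _ h2)
      obtain ⟨w, -, -, h3⟩ := key u hvu
      exact lt_irrefl _ h3
    · have key : ∀ y, Relation.ReflTransGen R v y →
          ∃ w : Fin n, Follows w y ∧ 2 * w.val + 1 ∈ S ∧ distFrom j u < distFrom j y := by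
        intro y hvy
        induction hvy with
        | refl => exact ⟨u, hf, hv, distFrom_lt hf (fun e => hjS (by rwa [← e])) hj⟩
        | tail _ hstep ih =>
          obtain ⟨w, h1, h2, h3⟩ := ih
          rcases hstep with ⟨h4, h5⟩ | ⟨h4, h5⟩
          · rw [h5.left_unique h1] at h4
            exact absurd h2 (h.succ _ h4)
          · exact ⟨_, h5, h4, h3.trans (distFrom_lt h5 (fun e => hjS (by rwa [← e])) hj)⟩
      obtain ⟨w, -, -, h3⟩ := key u hvu
      exact lt_irrefl _ h3
  · have mixed : ∀ {a b : Fin n}, 2 * b.val ∈ S → 2 * a.val + 1 ∈ S → Follows a b → False := by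
      intro a b hb ha hf
      rcases hf with hf | ⟨hf, hf'⟩
      · exact h.succ _ ha ((show 2 * b.val = 2 * a.val + 1 + 1 by omega) ▸ hb)
      · rw [hf'] at hb
        exact h.wrap ⟨hb, (show 2 * a.val + 1 = 2 * n - 1 by omega) ▸ ha⟩
    rcases hab with ⟨h1, h2⟩ | ⟨h1, h2⟩ <;> rcases hab' with ⟨h3, h4⟩ | ⟨h3, h4⟩
    · exact h2.right_unique h4
    · exact (mixed h1 h3 h4).elim
    · exact (mixed h3 h1 h2).elim
    · exact h2.left_unique h4

/-- The complex of directed trees of the doubled cycle. -/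
abbrev cycleComplex (n : ℕ) [NeZero n] : PreAbstractSimplicialComplex (Fin n × Fin n) :=
  directedTreeComplex (doubleDigraph (SimpleGraph.cycleGraph n))

theorem CycleIndep.mem_faces (hn : 3 ≤ n) {S : Finset ℕ} (h : CycleIndep (2 * n) S)
    (hne : S.Nonempty) (hS : S.card < n) :
    S.image (cycleEdge n) ∈ (cycleComplex n).faces := by
  refine ⟨hne.image _, ?_, h.isDirectedForest hS⟩
  rintro ⟨a, b⟩ hab
  rw [mem_image_cycleEdge h.lt] at hab
  refine (cycleGraph_adj_iff_follows hn a b).2 ?_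
  rcases hab with ⟨-, h⟩ | ⟨-, h⟩
  · exact Or.inr h
  · exact Or.inl h

theorem exists_cycleIndep_of_mem_faces (hn : 3 ≤ n) {T : Finset (Fin n × Fin n)}
    (hT : T ∈ (cycleComplex n).faces) :
    ∃ S, CycleIndep (2 * n) S ∧ T = S.image (cycleEdge n) := by
  obtain ⟨-, hadj, hforest⟩ := hT
  rw [isDirectedForest_iff] at hforest
  obtain ⟨hacyc, hin⟩ := hforest
  have hval : ∀ k, k < n → ∃ a : Fin n, a.val = k := fun k hk => ⟨⟨k, hk⟩, rfl⟩
  have hnext : ∀ a : Fin n, ∃ b, Follows a b := fun a => by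
    rcases lt_or_ge (a.val + 1) n with h | h
    · exact ⟨⟨a.val + 1, h⟩, Or.inl rfl⟩
    · exact ⟨⟨0, by omega⟩, Or.inr ⟨by omega, rfl⟩⟩
  have heven : ∀ {a b : Fin n}, Follows a b → cycleEdge n (2 * a.val) = (b, a) := fun {a b} hf =>
    (cycleEdge_eq_iff (by omega) b a).2 (Or.inl ⟨rfl, hf⟩)
  have hodd : ∀ {a b : Fin n}, Follows a b → cycleEdge n (2 * a.val + 1) = (a, b) :=
    fun {a b} hf => (cycleEdge_eq_iff (by omega) a b).2 (Or.inr ⟨rfl, hf⟩)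
  -- In-degree at most one forces `a = c`, although these vertices are two steps apart; this is
  -- impossible for n ≥ 3.
  have hmeet : ∀ {a b c : Fin n}, Follows a b → Follows b c → (a, b) ∈ T → (c, b) ∈ T → False := by
    intro a b c h1 h2 h3 h4
    obtain rfl := hin _ _ _ h3 h4
    have := a.isLt
    unfold Follows at h1 h2
    omega
  refine ⟨(Finset.range (2 * n)).filter fun x => cycleEdge n x ∈ T, ⟨?_, ?_, ?_⟩, ?_⟩
  · intro x hx
    exact Finset.mem_range.1 (Finset.mem_filter.1 hx).1
  · intro x hx hx1
    obtain ⟨hxn, hx⟩ := Finset.mem_filter.1 hx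
    obtain ⟨hxn1, hx1⟩ := Finset.mem_filter.1 hx1
    rw [Finset.mem_range] at hxn hxn1
    obtain ⟨a, ha⟩ := hval (x / 2) (by omega)
    obtain ⟨b, hab⟩ := hnext a
    rcases Nat.mod_two_eq_zero_or_one x with h | h
    · obtain rfl : x = 2 * a.val := by omega
      rw [heven hab] at hx
      rw [hodd hab] at hx1
      exact hacyc a (.tail (.single hx1) hx)
    · obtain rfl : x = 2 * a.val + 1 := by omega
      have hb : b.val = a.val + 1 := by
        unfold Follows at hab
        omega
      obtain ⟨c, hbc⟩ := hnext b
      rw [hodd hab] at hx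
      rw [show 2 * a.val + 1 + 1 = 2 * b.val by omega, heven hbc] at hx1
      exact hmeet hab hbc hx hx1
  · rintro ⟨h0, h1⟩
    have h0 := (Finset.mem_filter.1 h0).2
    have h1 := (Finset.mem_filter.1 h1).2
    obtain ⟨a, ha⟩ := hval (n - 1) (by omega)
    obtain ⟨b, hb⟩ := hval 0 (by omega)
    have hab : Follows a b := Or.inr ⟨by omega, hb⟩
    obtain ⟨c, hbc⟩ := hnext b
    rw [show 0 = 2 * b.val by omega, heven hbc] at h0
    rw [show 2 * n - 1 = 2 * a.val + 1 by omega, hodd hab] at h1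
    exact hmeet hab hbc h1 h0
  · ext ⟨a, b⟩
    rw [Finset.mem_image]
    constructor
    · intro hab
      rcases (cycleGraph_adj_iff_follows hn a b).1 (hadj _ hab) with hf | hf
      · refine ⟨2 * a.val + 1, Finset.mem_filter.2 ⟨Finset.mem_range.2 (by omega), ?_⟩, hodd hf⟩
        rwa [hodd hf]
      · refine ⟨2 * b.val, Finset.mem_filter.2 ⟨Finset.mem_range.2 (by omega), ?_⟩, heven hf⟩
        rwa [heven hf]
    · rintro ⟨x, hx, h⟩
      exact h ▸ (Finset.mem_filter.1 hx).2

theorem card_image_cycleEdge (hn : 3 ≤ n) {S : Finset ℕ} (h : CycleIndep (2 * n) S) :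
    (S.image (cycleEdge n)).card = S.card :=
  Finset.card_image_of_injOn ((cycleEdge_injOn hn).mono h.lt)

/-! ### Pure skeleta and their shellability -/

theorem exists_superset_mem_faces (hn : 3 ≤ n) {t : ℕ} (ht : 3 * t < 2 * n + 3)
    (htn : t < n) {T : Finset (Fin n × Fin n)} (hT : T ∈ (cycleComplex n).faces)
    (hcard : T.card ≤ t) : ∃ T' ∈ (cycleComplex n).faces, T ⊆ T' ∧ T'.card = t := by
  obtain ⟨S, hS, rfl⟩ := exists_cycleIndep_of_mem_faces hn hT
  have hne : S.Nonempty := Finset.image_nonempty.1 hT.1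
  rw [card_image_cycleEdge hn hS] at hcard
  obtain ⟨S', hSS', hc, hS'⟩ := hS.exists_superset (by omega) ht hcard
  exact ⟨_, hS'.mem_faces hn (hne.mono hSS') (by omega), Finset.image_subset_image hSS',
    by rw [card_image_cycleEdge hn hS', hc]⟩

theorem singleton_mem_faces (hn : 3 ≤ n) :
    ({0} : Finset ℕ).image (cycleEdge n) ∈ (cycleComplex n).faces :=
  CycleIndep.mem_faces hn ⟨by simp; omega, by simp, by simp; omega⟩ (by simp) (by simp; omega)

theorem isPureOfDimension_skeleton (hn : 3 ≤ n) {d : ℕ} (hd : 3 * d < 2 * n) (hdn : d + 1 < n) :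
    IsPureOfDimension (skeleton (cycleComplex n) d) d := by
  refine ⟨⟨?_, ?_⟩, ?_⟩
  · obtain ⟨T, hT, -, hc⟩ := exists_superset_mem_faces hn (t := d + 1) (by omega) hdn
      (singleton_mem_faces hn) (by simp)
    exact ⟨T, ⟨hT, hc.le⟩, hc⟩
  · rintro i ⟨T, hT, hi⟩
    have := hT.2
    omega
  · intro T hT hc
    obtain ⟨T', hT', h1, h2⟩ := exists_superset_mem_faces hn (t := d + 1) (by omega) hdn hT.1 hc.le
    exact ⟨T', ⟨hT', h2.le⟩, h1, h2⟩

theorem isGreatest_maxPureSkeletonDim_cycleComplex (hn : 3 ≤ n) :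
    IsGreatest {d : ℕ | ∃ k : ℕ, IsPureOfDimension (skeleton (cycleComplex n) k) d}
      (maxPureSkeletonDim (cycleComplex n)) :=
  isGreatest_maxPureSkeletonDim _ ⟨_, singleton_mem_faces hn⟩

/-- For these residues {1, 4, 7, …} is a maximal independent set with s elements, so no pure
skeleton of dimension s or more can exist: this face would have to be enlarged in it. -/
theorem maxPureSkeletonDim_lt (hn : 3 ≤ n) {s : ℕ} (hs : 1 ≤ s) (hsn : s < n)
    (h : 2 * n = 3 * s ∨ 2 * n + 1 = 3 * s) : maxPureSkeletonDim (cycleComplex n) < s := by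
  obtain ⟨k, ⟨⟨T, hT, hTc⟩, -⟩, hpure⟩ := (isGreatest_maxPureSkeletonDim_cycleComplex hn).1
  by_contra! hlt
  have hk := hT.2
  let S : Finset ℕ := (Finset.range (2 * n)).filter fun x => x % 3 = 1
  have hmem : ∀ x, x ∈ S ↔ x < 2 * n ∧ x % 3 = 1 := by simp [S]
  have hS : CycleIndep (2 * n) S := by
    refine ⟨fun x hx => ((hmem x).1 hx).1, fun x hx hx1 => ?_, fun hw => ?_⟩
    · rw [hmem] at hx hx1; omega
    · rw [hmem, hmem] at hw; omega
  have hcard : S.card = s := by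
    have : S = (Finset.range s).image fun i => 3 * i + 1 := by
      ext x
      rw [hmem, Finset.mem_image]
      constructor
      · rintro ⟨h1, h2⟩
        exact ⟨x / 3, Finset.mem_range.2 (by omega), by omega⟩
      · rintro ⟨i, hi, rfl⟩
        have := Finset.mem_range.1 hi
        omega
    rw [this, Finset.card_image_of_injective _ fun a b hab => by simpa using hab, Finset.card_range]
  have hface := hS.mem_faces hn (Finset.card_pos.1 (by omega)) (by omega)
  have hcard' := card_image_cycleEdge hn hS
  obtain ⟨T', hT', hsub, hc'⟩ := hpure _ ⟨hface, by omega⟩ (by omega)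
  obtain ⟨S', hS', rfl⟩ := exists_cycleIndep_of_mem_faces hn hT'.1
  rw [card_image_cycleEdge hn hS'] at hc'
  have hSS' : S ⊆ S' := by
    intro x hx
    obtain ⟨y, hy, he⟩ := Finset.mem_image.1 (hsub (Finset.mem_image_of_mem _ hx))
    rwa [cycleEdge_injOn hn (hS'.lt y hy) (hS.lt x hx) he] at hy
  obtain ⟨x, hx, hxS⟩ := Finset.exists_mem_notMem_of_card_lt_card (by omega : S.card < S'.card)
  have h1 := hS'.lt x hx
  have h2 : x + 1 ∉ S := fun h => hS'.succ x hx (hSS' h)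
  have h3 : x ≠ 0 → x - 1 ∉ S := fun h0 h => hS'.succ _ (hSS' h)
    ((show x - 1 + 1 = x by omega) ▸ hx)
  rw [hmem] at hxS h2 h3
  omega

theorem IsPureOfDimension.isFacet_iff {ι : Type*} {K : PreAbstractSimplicialComplex ι} {d : ℕ}
    (h : IsPureOfDimension K d) (s : Finset ι) : IsFacet K s ↔ s ∈ K.faces ∧ s.card = d + 1 := by
  have hle : ∀ t ∈ K.faces, t.card ≤ d + 1 := by
    intro t ht
    have hpos := (K.isRelLowerSet_faces ht).1.card_pos
    have := h.1.2 ⟨t, ht, (Nat.sub_add_cancel hpos).symm⟩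
    omega
  constructor
  · intro hs
    refine ⟨hs.1, ?_⟩
    by_contra hne
    have := hle s hs.1
    obtain ⟨t, ht, hst, hc⟩ := h.2 s hs.1 (by omega)
    have := Finset.card_le_card (hs.2 ht hst)
    omega
  · rintro ⟨hs, hc⟩
    refine ⟨hs, fun t ht hst => ?_⟩
    exact (Finset.eq_of_subset_of_card_le hst (by rw [hc]; exact hle t ht)).ge

theorem isShellable_skeleton (hn : 3 ≤ n) {d : ℕ} (hd : 3 * d + 2 ≤ 2 * n) (hdn : d + 1 < n) :
    IsShellable (skeleton (cycleComplex n) d) := by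
  have hpure := isPureOfDimension_skeleton hn (d := d) (by omega) hdn
  refine ⟨Or.inr ⟨d, hpure⟩, ?_⟩
  obtain ⟨𝓕, h𝓕, hmem⟩ := exists_shellExt_cycle (by omega : 3 ≤ 2 * n) hd
  obtain ⟨m, F, hinj, hF, hsh⟩ := (h𝓕.image (cycleEdge_injOn hn)
    fun S hS => ((hmem S).1 hS).1.lt).exists_fin
  refine ⟨m, F, hinj, fun s => ?_, hsh⟩
  rw [hpure.isFacet_iff, ← hF, Finset.mem_image]
  constructor
  · rintro ⟨hs, hc⟩
    obtain ⟨S, hS, rfl⟩ := exists_cycleIndep_of_mem_faces hn hs.1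
    rw [card_image_cycleEdge hn hS] at hc
    exact ⟨S, (hmem S).2 ⟨hS, hc⟩, rfl⟩
  · rintro ⟨S, hS, rfl⟩
    obtain ⟨hS, hc⟩ := (hmem S).1 hS
    have hc' := card_image_cycleEdge hn hS
    exact ⟨⟨hS.mem_faces hn (Finset.card_pos.1 (by omega)) (by omega), by omega⟩, by omega⟩

/-- Here 2n = 3t + 1 with t = 2k + 1. A lower bound on `d` suffices: shellability supplies purity,
and a face with t + 1 elements forces all facets to have at least that many, so `not_shelling_cycle`
applies after pulling back along `cycleEdge`. -/
theorem not_isShellable_skeleton (hn : 3 ≤ n) {k d : ℕ} (hk : n = 3 * k + 2) (hd : 2 * k + 1 ≤ d) :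
    ¬ IsShellable (skeleton (cycleComplex n) d) := by
  rintro ⟨hpure, m, F, -, hF, hsh⟩
  obtain ⟨T, hT, -, hTc⟩ := exists_superset_mem_faces hn (t := 2 * k + 2) (by omega) (by omega)
    (singleton_mem_faces hn) (by simp)
  have hTd : T ∈ (skeleton (cycleComplex n) d).faces := ⟨hT, by omega⟩
  rcases hpure with hempty | ⟨e, hpure⟩
  · rw [hempty] at hTd
    exact hTd
  have he : 2 * k + 1 ≤ e := hpure.1.2 ⟨T, hTd, hTc⟩
  have hfacet := hpure.isFacet_iff
  let G : Fin m → Finset ℕ := fun i => (Finset.range (2 * n)).filter fun x => cycleEdge n x ∈ F i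
  have hmemG : ∀ i x, x ∈ G i ↔ x < 2 * n ∧ cycleEdge n x ∈ F i := by simp [G]
  have hface : ∀ i, F i ∈ (skeleton (cycleComplex n) d).faces ∧ (F i).card = e + 1 :=
    fun i => (hfacet _).1 ((hF _).2 ⟨i, rfl⟩)
  have hGF : ∀ i, CycleIndep (2 * n) (G i) ∧ F i = (G i).image (cycleEdge n) := by
    intro i
    obtain ⟨S, hS, hFS⟩ := exists_cycleIndep_of_mem_faces hn (hface i).1.1
    have : G i = S := by
      ext x
      rw [hmemG, hFS, Finset.mem_image]
      constructor
      · rintro ⟨hx, y, hy, h⟩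
        rwa [cycleEdge_injOn hn (hS.lt y hy) hx h] at hy
      · exact fun hx => ⟨hS.lt x hx, x, hx, rfl⟩
    rw [this]
    exact ⟨hS, hFS⟩
  have hN : 2 * n = 3 * (2 * k + 1) + 1 := by omega
  refine not_shelling_cycle (t := 2 * k + 1) (by omega) (G := G) (fun i => hN ▸ (hGF i).1)
    (fun i => ?_) (fun A hA => ?_) fun i j hij => ?_
  · rw [← card_image_cycleEdge hn (hGF i).1, ← (hGF i).2, (hface i).2]
    omega
  · have hAi : CycleIndep (2 * n) A := hN ▸ hA.cycleIndep
    have hAc := hA.card_le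
    have hAne : A.Nonempty := by
      by_cases h1 : 1 ∈ A
      · exact ⟨1, h1⟩
      · exact ⟨2, by have := hA.2 0 (by omega); simp only [mul_zero, zero_add] at this; tauto⟩
    have hAf := hAi.mem_faces hn hAne (by omega)
    have hAc' := card_image_cycleEdge hn hAi
    obtain ⟨B, hB, hAB, hBc⟩ := hpure.2 _ ⟨hAf, by omega⟩ (by omega)
    obtain ⟨i, rfl⟩ := (hF B).1 ((hfacet B).2 ⟨hB, hBc⟩)
    exact ⟨i, fun x hx => (hmemG i x).2 ⟨hAi.lt x hx, hAB (Finset.mem_image_of_mem _ hx)⟩⟩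
  · obtain ⟨l, hl, v, hv, h1, h2⟩ := hsh i j hij
    rw [(hGF j).2] at hv
    obtain ⟨u, hu, rfl⟩ := Finset.mem_image.1 hv
    refine ⟨l, hl, u, hu, fun x hx => ?_, ?_⟩
    · simp only [Finset.mem_inter, hmemG] at hx ⊢
      have := Finset.mem_inter.1 (h1 (Finset.mem_inter.2 ⟨hx.1.2, hx.2.2⟩))
      exact ⟨⟨hx.1.1, this.1⟩, hx.2⟩
    · ext x
      have hx := Finset.ext_iff.1 h2 (cycleEdge n x)
      simp only [Finset.mem_inter, Finset.mem_sdiff, Finset.mem_singleton, hmemG] at hx ⊢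
      have hinj : x < 2 * n → (cycleEdge n x = cycleEdge n u ↔ x = u) := fun hx =>
        ⟨fun h => cycleEdge_injOn hn hx ((hGF j).1.lt u hu) h, fun h => h ▸ rfl⟩
      tauto

end CycleGraph

end TreeComplex

theorem mainTheorem5 (n : ℕ) (hn : 3 ≤ n) :
    TreeComplex.IsShellable
        (TreeComplex.skeleton
          (TreeComplex.directedTreeComplex
            (TreeComplex.doubleDigraph (SimpleGraph.cycleGraph n)))
          (TreeComplex.maxPureSkeletonDim
            (TreeComplex.directedTreeComplex
              (TreeComplex.doubleDigraph (SimpleGraph.cycleGraph n))))) ↔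
      ∃ k : ℕ, n = 3 * k ∨ n = 3 * k + 1 := by
  have : NeZero n := ⟨by omega⟩
  constructor
  · intro h
    by_contra! hk
    have h0 := hk (n / 3)
    -- With k = n / 3, purity of the (2k + 1)-skeleton bounds the maximal dimension from below.
    refine TreeComplex.not_isShellable_skeleton hn (k := n / 3) (by omega) ?_ h
    refine (TreeComplex.isGreatest_maxPureSkeletonDim_cycleComplex hn).2 ⟨2 * (n / 3) + 1, ?_⟩
    exact TreeComplex.isPureOfDimension_skeleton hn (by omega) (by omega)
  · rintro ⟨k, rfl | rfl⟩
    · have := TreeComplex.maxPureSkeletonDim_lt hn (s := 2 * k) (by omega) (by omega)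
        (by omega)
      unfold TreeComplex.cycleComplex at this
      exact TreeComplex.isShellable_skeleton hn (by omega) (by omega)
    · have := TreeComplex.maxPureSkeletonDim_lt hn (s := 2 * k + 1) (by omega) (by omega)
        (by omega)
      unfold TreeComplex.cycleComplex at this
      exact TreeComplex.isShellable_skeleton hn (by omega) (by omega)
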